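/- Let $\gamma,\gamma_0\in L^\infty(0,\pi)$ be real-valued with $\operatorname{ess\,inf}_{(0,\pi)}\gamma>0$, and let $\mathfrak L u=-\partial_x(\gamma\,\partial_x u)+\gamma_0u$ with domain $\{u\in H^1_0(0,\pi):\mathfrak Lu\in L^2(0,\pi)\}$. For $T>0$, $p\in W^{1,\infty}(0,\pi)$, $q\in L^\infty(0,\pi)$ and an open set $\omega\subseteq(0,\pi)$, consider the control system $$ (D)\qquad \begin{cases} \partial_t y_1+\mathfrak L y_1=\mathbb 1_\omega v,\\ \partial_t y_2+\mathfrak L y_2=-q\,y_1-p\,\partial_xy_1,\\ y(\cdot,0)=y(\cdot,\pi)=0,\qquad y(0)=y^0, \end{cases} $$ with state $y=(y_1,y_2)\in C^0([0,T],L^2(0,\pi)^2)\cap L^2(0,T;H^1_0(0,\pi)^2)$ (weak solution), initial state $y^0\in L^2(0,\pi)^2$ and control $v\in L^2((0,T)\times(0,\pi))$. The system is approximately controllable at time $T$ if for all $\varepsilon>0$ and all $y^0,y^1\in L^2(0,\pi)^2$ there is a control $v$ whose solution satisfies $\|y(T)-y^1\|_{L^2(0,\pi)^2}\le\varepsilon$.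 It is null controllable at time $T$ if for every $y^0\in L^2(0,\pi)^2$ there is a control $v$ whose solution satisfies $y(T)=0$. The support $\operatorname{supp}p$ is the set of points of $[0,\pi]$ near which $p$ is not almost everywhere zero. Take $q=0$. Then there exist a real-valued $p\in W^{1,\infty}(0,\pi)$ and an interval $\omega=(a,b)$ with $0<a<b<\pi$ such that $\operatorname{supp}p\cap\omega\ne\emptyset$ and, for every $T>0$, system $(D)$ is not approximately controllable at time $T$ and not null controllable at time $T$. Moreover, $p$ and $\omega$ can be chosen so that, in addition: (i) for some real eigenvalue $\lambda$ of $\mathfrak L$ and some eigenfunction $\phi_\lambda$ with $\|\phi_\lambda\|_{L^2(0,\pi)}=1$, the function $\phi_\lambda$ does not vanish on $\omega$, $p=1/\phi_\lambda$ almost everywhere on $\omega$, $\partial_x(p\phi_\lambda)\in L^2(0,\pi)$ and $$\int_0^a\partial_x(p\phi_\lambda)\,\phi_\lambda\,dx=\int_b^\pi\partial_x(p\phi_\lambda)\,\phi_\lambda\,dx=0;$$ (ii) if $\gamma=1$ and $\gamma_0=0$, so that $\mathfrak L=-\partial_x^2$, then $p\in W^{2,\infty}(\omega)$. Consequently the following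 claim of Duprez is false: if $\mathfrak L=-\partial_x^2$, $p\in W^{1,\infty}(0,\pi)\cap W^{2,\infty}(\omega)$, $q\in L^\infty(0,\pi)\cap W^{1,\infty}(\omega)$ and $(\operatorname{supp}p\cup\operatorname{supp}q)\cap\omega\neq\emptyset$, then $(D)$ is null controllable at every time $T>0$. -/

import Mathlib

open MeasureTheory Set Filter Topology
open scoped ENNReal ContDiff

namespace CascadeControl

/-- The space interval `(0, π)`. -/
def space : Set ℝ := Ioo 0 Real.pi

/-- Lebesgue measure on `(0, π)`. -/
noncomputable def spaceMeasure : Measure ℝ := volume.restrict space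

/-- `L²(0, π)`. -/
abbrev L2 : Type := Lp ℝ 2 spaceMeasure

/-- The state space `L²(0, π)²`, with its Hilbert product norm. -/
abbrev State : Type := WithLp 2 (L2 × L2)

/-- `g` is the weak (distributional) derivative of `f` on the open set `U`. -/
def HasWeakDerivOn (U : Set ℝ) (f g : ℝ → ℝ) : Prop :=
  LocallyIntegrableOn f U ∧ LocallyIntegrableOn g U ∧
    ∀ θ : ℝ → ℝ, ContDiff ℝ ∞ θ → HasCompactSupport θ → tsupport θ ⊆ U →
      (∫ x in U, f x * deriv θ x) = -(∫ x in U, g x * θ x)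

/-- `f ∈ W^{k,∞}(U)`. -/
def MemWInf (U : Set ℝ) : ℕ → (ℝ → ℝ) → Prop
  | 0, f => MemLp f ∞ (volume.restrict U)
  | k + 1, f => MemLp f ∞ (volume.restrict U) ∧ ∃ g, HasWeakDerivOn U f g ∧ MemWInf U k g

/-- `f ∈ H¹₀(0, π)` with weak derivative `g`: both are square integrable, and the continuous
representative of `f` vanishes at `0` and at `π`. -/
def IsH10 (f g : ℝ → ℝ) : Prop :=
  MemLp f 2 spaceMeasure ∧ MemLp g 2 spaceMeasure ∧ HasWeakDerivOn space f g ∧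
    ∃ F : ℝ → ℝ, ContinuousOn F (Icc 0 Real.pi) ∧ f =ᵐ[spaceMeasure] F ∧ F 0 = 0 ∧ F Real.pi = 0

/-- `u` lies in the domain `{u ∈ H¹₀(0, π) : 𝔏 u ∈ L²(0, π)}` of the operator
`𝔏 u = -(γ u')' + γ₀ u`, and `𝔏 u = h`. -/
def IsDivFormOp (γ γ₀ u h : ℝ → ℝ) : Prop :=
  MemLp h 2 spaceMeasure ∧ ∃ u' : ℝ → ℝ, IsH10 u u' ∧
    HasWeakDerivOn space (fun x => γ x * u' x) (fun x => γ₀ x * u x - h x)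

/-- `φ` is an `L²`-normalised eigenfunction of `𝔏` for the eigenvalue `l`. -/
def IsNormalizedEigenfunction (γ γ₀ : ℝ → ℝ) (l : ℝ) (φ : ℝ → ℝ) : Prop :=
  IsDivFormOp γ γ₀ φ (fun x => l * φ x) ∧ (∫ x in space, φ x ^ 2) = 1

/-- The support of (the class modulo null sets of) a function on `(0, π)`: the points near which
it is not almost everywhere zero. -/
def essSupport (f : ℝ → ℝ) : Set ℝ :=
  {x ∈ Icc 0 Real.pi | ∀ U ∈ 𝓝 x, spaceMeasure (U ∩ {z | f z ≠ 0}) ≠ 0}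

/-- `v ∈ L²((0, T) × (0, π))`. -/
def IsControl (T : ℝ) (v : ℝ × ℝ → ℝ) : Prop :=
  MemLp v 2 (volume.restrict (Ioo 0 T ×ˢ space))

/-- `y = (y₁, y₂) ∈ C⁰([0, T], L²(0, π)²) ∩ L²(0, T; H¹₀(0, π)²)` is the weak solution, with
`y(0) = y⁰` and homogeneous Dirichlet boundary conditions, of
`∂ₜ y₁ + 𝔏 y₁ = 1_O v` and `∂ₜ y₂ + 𝔏 y₂ = -q y₁ - p ∂ₓ y₁`,
where `𝔏 = -∂ₓ(γ ∂ₓ ·) + γ₀ ·`. Here `z` is `∂ₓ y`; the two equations are tested against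
`H¹₀(0, π)` in space and integrated over `(0, t)` in time. -/
structure IsSolution (γ γ₀ p q : ℝ → ℝ) (O : Set ℝ) (T : ℝ) (y0 : State)
    (v : ℝ × ℝ → ℝ) (y : ℝ → State) : Prop where
  continuousOn : ContinuousOn y (Icc 0 T)
  initial : y 0 = y0
  weak : ∃ z : ℝ → State, MemLp z 2 (volume.restrict (Ioo 0 T)) ∧
    (∀ᵐ t ∂(volume.restrict (Ioo 0 T)),
      IsH10 (y t).fst (z t).fst ∧ IsH10 (y t).snd (z t).snd) ∧
    ∀ t ∈ Icc 0 T, ∀ ψ ψ' : ℝ → ℝ, IsH10 ψ ψ' →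
      ((∫ x in space, (y t).fst x * ψ x) - (∫ x in space, y0.fst x * ψ x)
          + (∫ s in (0 : ℝ)..t, ∫ x in space,
              (γ x * (z s).fst x * ψ' x + γ₀ x * (y s).fst x * ψ x))
        = ∫ s in (0 : ℝ)..t, ∫ x in space, O.indicator (fun x => v (s, x)) x * ψ x) ∧
      ((∫ x in space, (y t).snd x * ψ x) - (∫ x in space, y0.snd x * ψ x)
          + (∫ s in (0 : ℝ)..t, ∫ x in space,
              (γ x * (z s).snd x * ψ' x + γ₀ x * (y s).snd x * ψ x))
        = ∫ s in (0 : ℝ)..t, ∫ x in space,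
              (-q x * (y s).fst x - p x * (z s).fst x) * ψ x)

/-- Approximate controllability at time `T`. -/
def ApproxControllable (γ γ₀ p q : ℝ → ℝ) (O : Set ℝ) (T : ℝ) : Prop :=
  ∀ ε > 0, ∀ y0 y1 : State, ∃ v, IsControl T v ∧
    ∃ y, IsSolution γ γ₀ p q O T y0 v y ∧ ‖y T - y1‖ ≤ ε

/-- Null controllability at time `T`. -/
def NullControllable (γ γ₀ p q : ℝ → ℝ) (O : Set ℝ) (T : ℝ) : Prop :=
  ∀ y0 : State, ∃ v, IsControl T v ∧ ∃ y, IsSolution γ γ₀ p q O T y0 v y ∧ y T = 0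

end CascadeControl

open CascadeControl

open scoped InnerProductSpace

/-- If `x ↦ ⟪T x, x⟫` is coercive modulo `‖A x‖²` with `A` compact, then its minimum over the
`x` in a closed subspace with `‖A x‖ = 1` is attained, at a solution of the Euler equation. -/
theorem exists_weak_eigenvector {E F : Type*} [NormedAddCommGroup E] [InnerProductSpace ℝ E]
    [CompleteSpace E] [NormedAddCommGroup F] [InnerProductSpace ℝ F]
    (T : E →L[ℝ] E) (hT : ∀ x y, ⟪T x, y⟫_ℝ = ⟪x, T y⟫_ℝ) (A : E →L[ℝ] F)
    (K : Submodule ℝ E) (hKc : IsClosed (K : Set E)) {c M : ℝ} (hc : 0 < c)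
    (hcoer : ∀ x, c * ‖x‖ ^ 2 ≤ ⟪T x, x⟫_ℝ + M * ‖A x‖ ^ 2)
    (hcomp : ∀ u : ℕ → E, (∃ C, ∀ n, ‖u n‖ ≤ C) →
      ∃ ν : ℕ → ℕ, StrictMono ν ∧ CauchySeq (fun n => A (u (ν n))))
    (hK : ∃ x ∈ K, A x ≠ 0) :
    ∃ l : ℝ, ∃ f ∈ K, ‖A f‖ = 1 ∧ ∀ η ∈ K, ⟪T f, η⟫_ℝ = l * ⟪A f, A η⟫_ℝ := by
  set S : Set ℝ := {r | ∃ x ∈ K, ‖A x‖ = 1 ∧ ⟪T x, x⟫_ℝ = r} with hS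
  have normalize : ∀ x ∈ K, A x ≠ 0 → (‖A x‖⁻¹ • x) ∈ K ∧ ‖A (‖A x‖⁻¹ • x)‖ = 1 := by
    intro x hx hAx
    refine ⟨K.smul_mem _ hx, ?_⟩
    rw [map_smul, norm_smul, norm_inv, norm_norm, inv_mul_cancel₀ (norm_ne_zero_iff.2 hAx)]
  have hSne : S.Nonempty := by
    obtain ⟨x, hx, hAx⟩ := hK
    exact ⟨_, _, (normalize x hx hAx).1, (normalize x hx hAx).2, rfl⟩
  have hSbdd : BddBelow S := by
    refine ⟨-M, ?_⟩
    rintro r ⟨x, hx, hAx, rfl⟩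
    have := hcoer x
    rw [hAx] at this
    nlinarith [sq_nonneg ‖x‖]
  set l := sInf S with hl
  have hlow : ∀ x ∈ K, 0 ≤ ⟪T x, x⟫_ℝ - l * ‖A x‖ ^ 2 := by
    intro x hx
    by_cases hAx : A x = 0
    · have := hcoer x
      rw [hAx] at this ⊢
      simp at this ⊢
      nlinarith [sq_nonneg ‖x‖]
    · have h1 : l ≤ _ := csInf_le hSbdd
        ⟨_, (normalize x hx hAx).1, (normalize x hx hAx).2, rfl⟩
      rw [map_smul, real_inner_smul_left, real_inner_smul_right] at h1
      have hpos : 0 < ‖A x‖ := norm_pos_iff.2 hAx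
      have h2 := mul_le_mul_of_nonneg_right h1 (sq_nonneg ‖A x‖)
      have : ‖A x‖⁻¹ * (‖A x‖⁻¹ * ⟪T x, x⟫_ℝ) * ‖A x‖ ^ 2 = ⟪T x, x⟫_ℝ := by field_simp
      linarith
  obtain ⟨r, -, hr, hrS⟩ := exists_seq_tendsto_sInf hSne hSbdd
  choose u huK huA hur using hrS
  obtain ⟨ρ, hρ⟩ := hr.bddAbove_range
  have hρ' : ∀ n, r n ≤ ρ := fun n => hρ (mem_range_self n)
  obtain ⟨ν, hν, hcauchy⟩ := hcomp u ⟨√((ρ + M) / c), fun n => by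
    apply Real.le_sqrt_of_sq_le
    rw [le_div_iff₀ hc]
    have := hcoer (u n)
    rw [huA, hur] at this
    nlinarith [hρ' n]⟩
  have hrν : Tendsto (fun n => r (ν n)) atTop (𝓝 l) := hr.comp hν.tendsto_atTop
  -- Parallelogram law for the form `⟪T x, x⟫`, with `hlow` bounding its value at `x + y` from
  -- below: near-minimisers whose images under `A` are close are themselves close.
  have hdist : ∀ x ∈ K, ∀ y ∈ K, ‖A x‖ = 1 → ‖A y‖ = 1 →
      c * ‖x - y‖ ^ 2 ≤ 2 * (⟪T x, x⟫_ℝ - l) + 2 * (⟪T y, y⟫_ℝ - l)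
        + (|M| + |l|) * ‖A x - A y‖ ^ 2 := by
    intro x hx y hy hAx hAy
    have h1 := hcoer (x - y)
    have h2 := hlow (x + y) (K.add_mem hx hy)
    have h3 := parallelogram_law_with_norm ℝ (A x) (A y)
    rw [hAx, hAy] at h3
    simp only [map_add, map_sub, inner_add_left, inner_add_right, inner_sub_left,
      inner_sub_right] at h1 h2
    have h4 : M * ‖A x - A y‖ ^ 2 ≤ |M| * ‖A x - A y‖ ^ 2 := by
      gcongr; exact le_abs_self M
    have h5 : l * ‖A x - A y‖ ^ 2 ≤ |l| * ‖A x - A y‖ ^ 2 := by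
      gcongr; exact le_abs_self l
    have h6 : l * (‖A x + A y‖ ^ 2 + ‖A x - A y‖ ^ 2) = l * 4 := by
      rw [h3]; ring
    nlinarith
  have hCu : CauchySeq (fun n => u (ν n)) := by
    rw [Metric.cauchySeq_iff'] at hcauchy ⊢
    intro ε hε
    set D := |M| + |l| + 1 with hD
    have hD0 : 0 < D := by positivity
    -- The two energy defects contribute at most `c * ε ^ 2 / 4` in `hdist`, and the `A` term at
    -- most `c * ε ^ 2 / 2`.
    have hδ : 0 < c * ε ^ 2 / 16 := by positivity
    have hev : ∀ᶠ n in atTop, r (ν n) - l < c * ε ^ 2 / 16 := by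
      have := hrν.sub_const l
      rw [sub_self] at this
      exact this.eventually_lt_const hδ
    obtain ⟨N1, hN1⟩ := eventually_atTop.1 hev
    have hcs : CauchySeq (fun n => A (u (ν n))) := Metric.cauchySeq_iff'.2 hcauchy
    obtain ⟨N2, hN2⟩ := Metric.cauchySeq_iff.1 hcs (√(c * ε ^ 2 / (2 * D))) (by positivity)
    refine ⟨max N1 N2, fun n hn => ?_⟩
    have hn1 := hN1 n (le_trans (le_max_left _ _) hn)
    have hm1 := hN1 (max N1 N2) (le_max_left _ _)
    have hn2 := hN2 n (le_trans (le_max_right _ _) hn) (max N1 N2) (le_max_right _ _)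
    have hd := hdist _ (huK (ν n)) _ (huK (ν (max N1 N2))) (huA _) (huA _)
    rw [hur, hur] at hd
    rw [dist_eq_norm] at hn2 ⊢
    have hsq : ‖A (u (ν n)) - A (u (ν (max N1 N2)))‖ ^ 2 ≤ c * ε ^ 2 / (2 * D) := by
      have := Real.lt_sqrt (norm_nonneg _) |>.1 hn2
      exact this.le
    have h7 : (|M| + |l|) * ‖A (u (ν n)) - A (u (ν (max N1 N2)))‖ ^ 2 ≤ c * ε ^ 2 / 2 := by
      calc _ ≤ D * (c * ε ^ 2 / (2 * D)) := by
            gcongr; rw [hD]; linarith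
        _ = _ := by field_simp
    have h8 : c * ‖u (ν n) - u (ν (max N1 N2))‖ ^ 2 < c * ε ^ 2 := by nlinarith
    exact lt_of_pow_lt_pow_left₀ 2 hε.le (lt_of_mul_lt_mul_left h8 hc.le)
  obtain ⟨f, hf⟩ := cauchySeq_tendsto_of_complete hCu
  have hfK : f ∈ K := hKc.mem_of_tendsto hf (Eventually.of_forall fun n => huK _)
  have hAf : ‖A f‖ = 1 := by
    refine tendsto_nhds_unique (((A.continuous.tendsto f).comp hf).norm) ?_
    simp only [Function.comp_def, huA]
    exact tendsto_const_nhds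
  have hTf : ⟪T f, f⟫_ℝ = l := by
    refine tendsto_nhds_unique (((T.continuous.tendsto f).comp hf).inner hf) ?_
    simpa only [Function.comp_def, hur] using hrν
  refine ⟨l, f, hfK, hAf, fun η hη => ?_⟩
  set b := ⟪T f, η⟫_ℝ - l * ⟪A f, A η⟫_ℝ with hb
  set d := ⟪T η, η⟫_ℝ - l * ‖A η‖ ^ 2 with hd
  have hd0 : 0 ≤ d := hlow η hη
  -- Minimality along the line `f + t • η`; the constant term vanishes because `f` attains the
  -- minimum.
  have key : ∀ t : ℝ, 0 ≤ 2 * t * b + t ^ 2 * d := by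
    intro t
    have h1 := hlow (f + t • η) (K.add_mem hfK (K.smul_mem _ hη))
    have h2 : ‖A (f + t • η)‖ ^ 2 = 1 + 2 * t * ⟪A f, A η⟫_ℝ + t ^ 2 * ‖A η‖ ^ 2 := by
      rw [map_add, map_smul, norm_add_sq_real, hAf, real_inner_smul_right, norm_smul, mul_pow,
        Real.norm_eq_abs, sq_abs]
      ring
    have h3 : ⟪T η, f⟫_ℝ = ⟪T f, η⟫_ℝ := by rw [hT, real_inner_comm]
    rw [h2, map_add, map_smul, inner_add_left, inner_add_right, inner_add_right,
      real_inner_smul_left, real_inner_smul_right, real_inner_smul_left, real_inner_smul_right, h3,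
      hTf] at h1
    rw [hb, hd]
    linarith
  -- Near the minimiser of the quadratic; `d + 1` instead of `d` keeps the denominator positive when
  -- `d = 0`.
  have h1 := key (-b / (d + 1))
  have h2 : 2 * (-b / (d + 1)) * b + (-b / (d + 1)) ^ 2 * d = -(b ^ 2 * (d + 2)) / (d + 1) ^ 2 := by
    field_simp; ring
  rw [h2, le_div_iff₀ (by positivity)] at h1
  have h3 : b ^ 2 = 0 := by nlinarith [sq_nonneg b, mul_nonneg (sq_nonneg b) hd0]
  have h4 : b = 0 := pow_eq_zero_iff (two_ne_zero) |>.1 h3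
  linarith

/-! ### Calculus of absolutely continuous functions -/

/-- `u` is absolutely continuous on `[c, d]`, with almost everywhere derivative `u'`. -/
def IsPrim (c d : ℝ) (u u' : ℝ → ℝ) : Prop :=
  AbsolutelyContinuousOnInterval u c d ∧ ∀ᵐ x, x ∈ Ioo c d → HasDerivAt u (u' x) x

/-- A function that varies no more than a multiple of an absolutely continuous one is absolutely
continuous. -/
theorem AbsolutelyContinuousOnInterval.of_dist_le {f g : ℝ → ℝ} {c d C : ℝ}
    (hf : AbsolutelyContinuousOnInterval f c d)
    (h : ∀ x ∈ uIcc c d, ∀ y ∈ uIcc c d, dist (g x) (g y) ≤ C * dist (f x) (f y)) :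
    AbsolutelyContinuousOnInterval g c d := by
  have hf' : Tendsto _ _ _ := hf
  apply squeeze_zero' ?_ ?_ (by simpa using hf'.const_mul C)
  · exact Filter.Eventually.of_forall fun _ ↦ Finset.sum_nonneg (fun i _ ↦ dist_nonneg)
  rw [eventually_inf_principal]
  filter_upwards with I hI
  rw [Finset.mul_sum]
  gcongr with i hi
  simp only [AbsolutelyContinuousOnInterval.disjWithin, mem_ofPred_eq] at hI
  exact h _ (hI.1 i hi).1 _ (hI.1 i hi).2

namespace IsPrim

variable {c d : ℝ} {u u' v v' : ℝ → ℝ}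

theorem continuousOn (hu : IsPrim c d u u') (hcd : c ≤ d) : ContinuousOn u (Icc c d) := by
  simpa [uIcc_of_le hcd] using hu.1.continuousOn

theorem mul (hu : IsPrim c d u u') (hv : IsPrim c d v v') :
    IsPrim c d (fun x => u x * v x) (fun x => u' x * v x + u x * v' x) := by
  refine ⟨hu.1.fun_mul hv.1, ?_⟩
  filter_upwards [hu.2, hv.2] with x h1 h2 hx
  exact (h1 hx).mul (h2 hx)

theorem add (hu : IsPrim c d u u') (hv : IsPrim c d v v') :
    IsPrim c d (fun x => u x + v x) (fun x => u' x + v' x) := by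
  refine ⟨hu.1.fun_add hv.1, ?_⟩
  filter_upwards [hu.2, hv.2] with x h1 h2 hx
  exact (h1 hx).add (h2 hx)

theorem const_mul (r : ℝ) (hu : IsPrim c d u u') :
    IsPrim c d (fun x => r * u x) (fun x => r * u' x) := by
  refine ⟨hu.1.const_mul r, ?_⟩
  filter_upwards [hu.2] with x h1 hx
  exact (h1 hx).const_mul r

theorem congr_deriv (hu : IsPrim c d u u') (h : ∀ᵐ x, x ∈ Ioo c d → u' x = v' x) :
    IsPrim c d u v' := by
  refine ⟨hu.1, ?_⟩
  filter_upwards [hu.2, h] with x h1 h2 hx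
  exact h2 hx ▸ h1 hx

theorem congr (hu : IsPrim c d u u') (hcd : c ≤ d) (h : ∀ x ∈ Icc c d, u x = v x) :
    IsPrim c d v u' := by
  refine ⟨hu.1.of_dist_le (C := 1) fun x hx y hy => ?_, ?_⟩
  · rw [uIcc_of_le hcd] at hx hy
    rw [h x hx, h y hy, one_mul]
  · filter_upwards [hu.2] with x h1 hx
    refine (h1 hx).congr_of_eventuallyEq ?_
    filter_upwards [Ioo_mem_nhds hx.1 hx.2] with y hy
    exact (h y (Ioo_subset_Icc_self hy)).symm

theorem mono {c' d' : ℝ} (hu : IsPrim c d u u') (hcd : c' ≤ d') (hc : c ≤ c') (hd : d' ≤ d) :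
    IsPrim c' d' u u' := by
  refine ⟨hu.1.mono ?_, ?_⟩
  · rw [uIcc_of_le hcd, uIcc_of_le (hc.trans (hcd.trans hd))]
    exact Icc_subset_Icc hc hd
  · filter_upwards [hu.2] with x h1 hx
    exact h1 ⟨hc.trans_lt hx.1, hx.2.trans_le hd⟩

theorem deriv_ae (hu : IsPrim c d u u') (hcd : c ≤ d) :
    ∀ᵐ x, x ∈ uIoc c d → deriv u x = u' x := by
  have : ∀ᵐ x : ℝ, x ≠ d := by simp [ae_iff]
  filter_upwards [hu.2, this] with x h1 h2 hx
  rw [uIoc_of_le hcd] at hx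
  exact (h1 ⟨hx.1, lt_of_le_of_ne hx.2 h2⟩).deriv

theorem intervalIntegrable (hu : IsPrim c d u u') (hcd : c ≤ d) :
    IntervalIntegrable u' volume c d := by
  refine hu.1.intervalIntegrable_deriv.congr_ae ?_
  rw [Filter.EventuallyEq, ae_restrict_iff' measurableSet_uIoc]
  exact hu.deriv_ae hcd

theorem integral_eq_sub (hu : IsPrim c d u u') (hcd : c ≤ d) :
    ∫ x in c..d, u' x = u d - u c := by
  rw [← hu.1.integral_deriv_eq_sub]
  refine intervalIntegral.integral_congr_ae ?_
  filter_upwards [hu.deriv_ae hcd] with x h1 hx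
  exact (h1 hx).symm

/-- Integration by parts. -/
theorem integral_mul_add (hu : IsPrim c d u u') (hv : IsPrim c d v v') (hcd : c ≤ d) :
    ∫ x in c..d, (u' x * v x + u x * v' x) = u d * v d - u c * v c :=
  (hu.mul hv).integral_eq_sub hcd

theorem of_integral {g : ℝ → ℝ} {e : ℝ} (hg : IntervalIntegrable g volume c d)
    (he : e ∈ Icc c d) : IsPrim c d (fun x => ∫ t in e..x, g t) g := by
  have hcd : c ≤ d := he.1.trans he.2
  refine ⟨hg.absolutelyContinuousOnInterval_intervalIntegral (uIcc_of_le hcd ▸ he), ?_⟩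
  filter_upwards [hg.ae_hasDerivAt_integral] with x h1 hx
  rw [uIcc_of_le hcd] at h1
  exact h1 (Ioo_subset_Icc_self hx) e he

theorem const (r : ℝ) : IsPrim c d (fun _ => r) (fun _ => 0) :=
  ⟨LipschitzOnWith.absolutelyContinuousOnInterval (K := 0) (LipschitzWith.const r).lipschitzOnWith,
    Eventually.of_forall fun x _ => hasDerivAt_const x r⟩

theorem of_contDiff {θ : ℝ → ℝ} (hθ : ContDiff ℝ 1 θ) : IsPrim c d θ (deriv θ) :=
  ⟨hθ.contDiffOn.absolutelyContinuousOnInterval,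
    Eventually.of_forall fun x _ => (hθ.differentiable (by simp) x).hasDerivAt⟩

theorem hasWeakDerivOn (hu : IsPrim c d u u') (hcd : c ≤ d) :
    HasWeakDerivOn (Ioo c d) u u' := by
  have hi : IntegrableOn u' (Ioo c d) := by
    have := (intervalIntegrable_iff_integrableOn_Ioo_of_le hcd).1 (hu.intervalIntegrable hcd)
    exact this
  refine ⟨((hu.continuousOn hcd).mono Ioo_subset_Icc_self).locallyIntegrableOn
    measurableSet_Ioo, hi.locallyIntegrableOn, fun θ hθ _ hs => ?_⟩
  have hθ' : IsPrim c d θ (deriv θ) := of_contDiff (hθ.of_le (by simp))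
  have h := hu.integral_mul_add hθ' hcd
  have hc0 : θ c = 0 := image_eq_zero_of_notMem_tsupport fun h => (hs h).1.ne rfl
  have hd0 : θ d = 0 := image_eq_zero_of_notMem_tsupport fun h => (hs h).2.ne rfl
  rw [hc0, hd0, mul_zero, mul_zero, sub_zero, intervalIntegral.integral_add] at h
  · rw [← integral_Ioc_eq_integral_Ioo, ← integral_Ioc_eq_integral_Ioo,
      ← intervalIntegral.integral_of_le hcd, ← intervalIntegral.integral_of_le hcd]
    linarith
  · exact (hu.intervalIntegrable hcd).mul_continuousOn
      (by rw [uIcc_of_le hcd]; exact hθ'.continuousOn hcd)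
  · exact (hθ'.intervalIntegrable hcd).continuousOn_mul
      (by rw [uIcc_of_le hcd]; exact hu.continuousOn hcd)

theorem memLp_top (hu : IsPrim c d u u') (hcd : c ≤ d) :
    MemLp u ∞ (volume.restrict (Ioo c d)) := by
  obtain ⟨C, hC⟩ := isCompact_Icc.exists_bound_of_continuousOn (hu.continuousOn hcd)
  refine memLp_top_of_bound (((hu.continuousOn hcd).mono
    Ioo_subset_Icc_self).aestronglyMeasurable measurableSet_Ioo) C ?_
  filter_upwards [ae_restrict_mem measurableSet_Ioo] with x hx
  exact hC x (Ioo_subset_Icc_self hx)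

theorem memWInf_one (hu : IsPrim c d u u') (hcd : c ≤ d)
    (hu' : MemLp u' ∞ (volume.restrict (Ioo c d))) : MemWInf (Ioo c d) 1 u :=
  ⟨hu.memLp_top hcd, u', hu.hasWeakDerivOn hcd, hu'⟩

/-- The quotient `u / w`, where `w ≥ m > 0` wherever `u ≠ 0`. -/
theorem mul_inv_max {w w' : ℝ → ℝ} {m α β : ℝ} (hm : 0 < m) (hu : IsPrim c d u u')
    (hw : IsPrim c d w w') (hu0 : ∀ x ∈ Icc c d, x ∉ Icc α β → u x = 0)
    (hwm : ∀ x ∈ Icc α β, m ≤ w x) :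
    IsPrim c d (fun x => u x * (max (w x) m)⁻¹)
      (fun x => u' x * (max (w x) m)⁻¹ - u x * w' x * (max (w x) m)⁻¹ ^ 2) := by
  have hpos : ∀ x, 0 < max (w x) m := fun x => hm.trans_le (le_max_right _ _)
  refine ⟨hu.1.fun_mul (hw.1.of_dist_le (C := (m ^ 2)⁻¹) fun x _ y _ => ?_), ?_⟩
  · have h1 : dist (max (w x) m) (max (w y) m) ≤ dist (w x) (w y) := by
      simp only [Real.dist_eq]
      exact abs_max_sub_max_le_abs _ _ _
    rw [Real.dist_eq, inv_sub_inv (hpos x).ne' (hpos y).ne', abs_div, ← Real.dist_eq, dist_comm,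
      div_eq_inv_mul, abs_of_pos (mul_pos (hpos x) (hpos y))]
    gcongr
    rw [sq]
    gcongr <;> exact le_max_right _ _
  -- The truncation may fail to be differentiable at points where `w` crosses `m`. Inside `(α, β)`
  -- it is inactive, off `[α, β]` the factor `u` vanishes locally, and the two end points are
  -- negligible.
  · have hα : ∀ᵐ x : ℝ, x ≠ α := by simp [ae_iff]
    have hβ : ∀ᵐ x : ℝ, x ≠ β := by simp [ae_iff]
    filter_upwards [hu.2, hw.2, hα, hβ] with x h1 h2 hxα hxβ hx
    by_cases hxm : x ∈ Icc α β
    · have hx' : Ioo α β ∈ 𝓝 x :=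
        Ioo_mem_nhds (lt_of_le_of_ne hxm.1 hxα.symm) (lt_of_le_of_ne hxm.2 hxβ)
      have hwx : max (w x) m = w x := max_eq_left (hwm x hxm)
      have h3 : HasDerivAt (fun y => u y * (w y)⁻¹) _ x :=
        (h1 hx).mul ((h2 hx).fun_inv (hm.trans_le (hwm x hxm)).ne')
      have h4 : (fun y => u y * (max (w y) m)⁻¹) =ᶠ[𝓝 x] fun y => u y * (w y)⁻¹ := by
        filter_upwards [hx'] with y hy
        rw [max_eq_left (hwm y (Ioo_subset_Icc_self hy))]
      refine (h3.congr_of_eventuallyEq h4).congr_deriv ?_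
      rw [hwx]
      ring
    · have hev : ∀ᶠ y in 𝓝 x, u y = 0 := by
        filter_upwards [isClosed_Icc.isOpen_compl.mem_nhds hxm, Ioo_mem_nhds hx.1 hx.2]
          with y hy hy'
        exact hu0 y (Ioo_subset_Icc_self hy') hy
      have hu'0 : u' x = 0 :=
        (h1 hx).unique ((hasDerivAt_const x (0 : ℝ)).congr_of_eventuallyEq hev)
      rw [hu'0, hev.self_of_nhds]
      simp only [zero_mul, sub_zero]
      refine (hasDerivAt_const x (0 : ℝ)).congr_of_eventuallyEq ?_
      filter_upwards [hev] with y hy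
      rw [hy, zero_mul]

end IsPrim

/-! ### From weak derivatives to absolutely continuous representatives -/

/-- **Du Bois-Reymond**: a function on an interval whose weak derivative vanishes is constant. -/
theorem CascadeControl.HasWeakDerivOn.ae_eq_const {c d : ℝ} (hcd : c < d) {f : ℝ → ℝ}
    (hf : HasWeakDerivOn (Ioo c d) f fun _ => 0) :
    ∃ r : ℝ, ∀ᵐ x, x ∈ Ioo c d → f x = r := by
  obtain ⟨hfl, -, hf⟩ := hf
  simp only [zero_mul, integral_zero, neg_zero] at hf
  set e := (c + d) / 2 with he
  let bump : ContDiffBump e := ⟨(d - c) / 8, (d - c) / 4, by linarith, by linarith⟩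
  set ρ : ℝ → ℝ := bump.normed volume with hρ
  have hρs : tsupport ρ ⊆ Ioo c d := by
    rw [hρ, bump.tsupport_normed_eq]
    intro x hx
    rw [Metric.mem_closedBall, Real.dist_eq, abs_le] at hx
    have : bump.rOut = (d - c) / 4 := rfl
    rw [this] at hx
    constructor <;> linarith [hx.1, hx.2]
  have hρc : HasCompactSupport ρ := bump.hasCompactSupport_normed
  have hρd : ContDiff ℝ ∞ ρ := bump.contDiff_normed
  have hρ1 : ∫ x, ρ x = 1 := bump.integral_normed
  have hint : ∀ θ : ℝ → ℝ, Continuous θ → HasCompactSupport θ → tsupport θ ⊆ Ioo c d →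
      IntegrableOn (fun x => θ x * f x) (Ioo c d) := by
    intro θ h1 h2 h3
    have h4 : IntegrableOn f (tsupport θ) := hfl.integrableOn_compact_subset h3 h2
    have h5 : IntegrableOn (fun x => θ x * f x) (tsupport θ) :=
      h4.continuousOn_mul h1.continuousOn h2
    have h6 : Integrable (fun x => θ x * f x) := by
      refine (integrableOn_iff_integrable_of_support_subset ?_).1 h5
      intro x hx
      exact subset_tsupport _ (left_ne_zero_of_mul hx)
    exact h6.integrableOn
  set r := ∫ x in Ioo c d, ρ x * f x with hr
  have hzero : ∀ θ : ℝ → ℝ, ContDiff ℝ ∞ θ → HasCompactSupport θ → tsupport θ ⊆ Ioo c d →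
      ∫ x, θ x • (f x - r) = 0 := by
    intro θ hθd hθc hθs
    set I := ∫ x, θ x with hI
    -- Subtracting the mean makes the primitive of `η` compactly supported in `(c, d)`, hence an
    -- admissible test function.
    set η : ℝ → ℝ := fun x => θ x - I * ρ x with hη
    have hηd : ContDiff ℝ ∞ η := hθd.sub (contDiff_const.mul hρd)
    have hθi : Integrable θ := hθd.continuous.integrable_of_hasCompactSupport hθc
    have hρi : Integrable ρ := hρd.continuous.integrable_of_hasCompactSupport hρc
    have hηint : ∫ x, η x = 0 := by
      rw [hη, integral_sub hθi (hρi.const_mul I), integral_const_mul, hρ1, mul_one, sub_self]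
    have hKc : IsCompact (tsupport θ ∪ tsupport ρ) := IsCompact.union hθc hρc
    have hKne : (tsupport θ ∪ tsupport ρ).Nonempty := by
      refine ⟨e, Or.inr ?_⟩
      rw [hρ, bump.tsupport_normed_eq]
      exact Metric.mem_closedBall_self bump.rOut_pos.le
    have hKs : tsupport θ ∪ tsupport ρ ⊆ Ioo c d := union_subset hθs hρs
    obtain ⟨s, hsK, hs⟩ := hKc.exists_isLeast hKne
    obtain ⟨t, htK, ht⟩ := hKc.exists_isGreatest hKne
    have hη0 : ∀ x, x ∉ Icc s t → η x = 0 := by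
      intro x hx
      have hxK : x ∉ tsupport θ ∪ tsupport ρ := fun h => hx ⟨hs h, ht h⟩
      rw [mem_union, not_or] at hxK
      simp only [hη, image_eq_zero_of_notMem_tsupport hxK.1,
        image_eq_zero_of_notMem_tsupport hxK.2, mul_zero, sub_zero]
    set Θ : ℝ → ℝ := fun x => ∫ y in c..x, η y with hΘ
    have hΘ' : ∀ x, HasDerivAt Θ (η x) x := fun x =>
      intervalIntegral.integral_hasDerivAt_right (hηd.continuous.intervalIntegrable _ _)
        (hηd.continuous.stronglyMeasurableAtFilter _ _) hηd.continuous.continuousAt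
    have hdΘ : deriv Θ = η := funext fun x => (hΘ' x).deriv
    have hΘd : ContDiff ℝ ∞ Θ :=
      contDiff_infty_iff_deriv.2 ⟨fun x => (hΘ' x).differentiableAt, hdΘ ▸ hηd⟩
    have hΘ0 : ∀ x, x ∉ Icc s t → Θ x = 0 := by
      intro x hx
      by_cases hxs : x < s
      · refine intervalIntegral.integral_zero_ae (Eventually.of_forall fun y hy => hη0 y fun h => ?_)
        have : y ≤ max c x := hy.2
        have h2 : max c x < s := max_lt (hKs hsK).1 hxs
        linarith [h.1]
      · have hxt : t < x := by
          by_contra h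
          exact hx ⟨not_lt.1 hxs, not_lt.1 h⟩
        have hcx : c ≤ x := ((hKs htK).1.trans hxt).le
        rw [hΘ, ← hηint]
        simp only
        rw [intervalIntegral.integral_of_le hcx]
        refine setIntegral_eq_integral_of_forall_compl_eq_zero fun y hy => hη0 y fun h => hy ?_
        exact ⟨(hKs hsK).1.trans_le h.1, h.2.trans hxt.le⟩
    have hΘs : tsupport Θ ⊆ Icc s t :=
      closure_minimal (fun x hx => by_contra fun h => hx (hΘ0 x h)) isClosed_Icc
    have h1 := hf Θ hΘd (isCompact_Icc.of_isClosed_subset (isClosed_tsupport _) hΘs)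
      (hΘs.trans (Icc_subset_Ioo (hKs hsK).1 (hKs htK).2))
    have hθf := hint θ hθd.continuous hθc hθs
    have hρf := hint ρ hρd.continuous hρc hρs
    have h2 : ∫ x in Ioo c d, f x * deriv Θ x = (∫ x in Ioo c d, θ x * f x) - I * r := by
      rw [hr, ← integral_const_mul, ← integral_sub hθf (hρf.const_mul I)]
      refine integral_congr_ae (Eventually.of_forall fun x => ?_)
      simp only [hdΘ, hη]
      ring
    have h3 : ∫ x, θ x • (f x - r) = ∫ x in Ioo c d, (θ x * f x - r * θ x) := by
      rw [← setIntegral_eq_integral_of_forall_compl_eq_zero (s := Ioo c d)]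
      · refine integral_congr_ae (Eventually.of_forall fun x => ?_)
        simp only [smul_eq_mul]
        ring
      · intro x hx
        rw [image_eq_zero_of_notMem_tsupport fun h => hx (hθs h), zero_smul]
    have h4 : ∫ x in Ioo c d, θ x = I :=
      setIntegral_eq_integral_of_forall_compl_eq_zero fun x hx =>
        image_eq_zero_of_notMem_tsupport fun h => hx (hθs h)
    rw [h3, integral_sub hθf (hθi.integrableOn.const_mul r), integral_const_mul, h4]
    linarith
  refine ⟨r, ?_⟩
  have := isOpen_Ioo.ae_eq_zero_of_integral_contDiff_smul_eq_zero (U := Ioo c d)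
    (hfl.sub ((locallyIntegrable_const r).locallyIntegrableOn _)) hzero
  filter_upwards [this] with x hx hxU
  exact sub_eq_zero.1 (hx hxU)

instance : IsFiniteMeasure spaceMeasure := by
  unfold spaceMeasure space; infer_instance

theorem ae_spaceMeasure_iff {P : ℝ → Prop} :
    (∀ᵐ x ∂spaceMeasure, P x) ↔ ∀ᵐ x, x ∈ Ioo 0 Real.pi → P x :=
  ae_restrict_iff' measurableSet_Ioo

theorem integral_space_eq (f : ℝ → ℝ) :
    ∫ x in space, f x = ∫ x in (0 : ℝ)..Real.pi, f x := by
  rw [intervalIntegral.integral_of_le Real.pi_pos.le, integral_Ioc_eq_integral_Ioo, space]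

theorem MeasureTheory.MemLp.intervalIntegrable_space {g : ℝ → ℝ} {q : ℝ≥0∞}
    (hg : MemLp g q spaceMeasure) (hq : 1 ≤ q) : IntervalIntegrable g volume 0 Real.pi := by
  rw [intervalIntegrable_iff_integrableOn_Ioo_of_le Real.pi_pos.le]
  exact hg.integrable hq

theorem IsPrim.memLp_two {u u' : ℝ → ℝ} (hu : IsPrim 0 Real.pi u u') : MemLp u 2 spaceMeasure :=
  (show MemLp u ∞ spaceMeasure from hu.memLp_top Real.pi_pos.le).mono_exponent le_top

theorem IsPrim.isH10 {u u' : ℝ → ℝ} (hu : IsPrim 0 Real.pi u u') (hu' : MemLp u' 2 spaceMeasure)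
    (h0 : u 0 = 0) (hπ : u Real.pi = 0) : IsH10 u u' :=
  ⟨hu.memLp_two, hu', hu.hasWeakDerivOn Real.pi_pos.le, u, hu.continuousOn Real.pi_pos.le,
    ae_eq_refl _, h0, hπ⟩

/-- The primitive of `g` from `0` differs from `f` by a function with zero weak derivative, so by a
constant, which the boundary value at `0` determines. This gives access to classical integration by
parts against `H¹₀` functions. -/
theorem CascadeControl.IsH10.exists_isPrim {f g : ℝ → ℝ} (h : IsH10 f g) :
    ∃ F, IsPrim 0 Real.pi F g ∧ f =ᵐ[spaceMeasure] F ∧ F 0 = 0 ∧ F Real.pi = 0 := by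
  obtain ⟨hf, hg, hfg, F, hFc, hfF, hF0, hFπ⟩ := h
  have hπ := Real.pi_pos
  have hgi := hg.intervalIntegrable_space one_le_two
  have hV : IsPrim 0 Real.pi (fun x => ∫ t in (0 : ℝ)..x, g t) g :=
    IsPrim.of_integral hgi ⟨le_rfl, hπ.le⟩
  have hVw := hV.hasWeakDerivOn hπ.le
  have hbound : ∀ {v θ : ℝ → ℝ}, LocallyIntegrableOn v space → ContDiff ℝ ∞ θ →
      HasCompactSupport θ → tsupport θ ⊆ space → IntegrableOn (fun x => v x * deriv θ x) space := by
    intro v θ hv hθ hθc hθs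
    have hc : HasCompactSupport (deriv θ) := hθc.deriv
    have hs : tsupport (deriv θ) ⊆ space :=
      (closure_minimal (support_deriv_subset) (isClosed_tsupport θ)).trans hθs
    have h5 : IntegrableOn (fun x => v x * deriv θ x) (tsupport (deriv θ)) :=
      (hv.integrableOn_compact_subset hs hc).mul_continuousOn
        (hθ.continuous_deriv (by simp)).continuousOn hc
    refine ((integrableOn_iff_integrable_of_support_subset ?_).1 h5).integrableOn
    intro x hx
    exact subset_tsupport _ (right_ne_zero_of_mul hx)
  have hdiff : HasWeakDerivOn (Ioo 0 Real.pi) (fun x => f x - ∫ t in (0 : ℝ)..x, g t)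
      fun _ => 0 := by
    refine ⟨hfg.1.sub hVw.1, (locallyIntegrable_const _).locallyIntegrableOn _,
      fun θ hθ hθc hθs => ?_⟩
    simp only [sub_mul, zero_mul, integral_zero, neg_zero]
    have h1 := hbound hfg.1 hθ hθc hθs
    have h2 := hbound hVw.1 hθ hθc hθs
    have h3 := hfg.2.2 θ hθ hθc hθs
    have h4 := hVw.2.2 θ hθ hθc hθs
    unfold space at h1 h2 h3
    rw [integral_sub h1 h2, h3, h4, sub_self]
  obtain ⟨r, hr⟩ := hdiff.ae_eq_const hπ
  -- Both sides are continuous on the closed interval, so the almost everywhere identity reaches the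
  -- end points.
  have hFV : EqOn (fun x => F x - ∫ t in (0 : ℝ)..x, g t) (fun _ => r) (Icc 0 Real.pi) := by
    refine Measure.eqOn_Icc_of_ae_eq volume hπ.ne ?_ (hFc.sub (hV.continuousOn hπ.le))
      continuousOn_const
    rw [← restrict_Ioo_eq_restrict_Icc]
    have h1 : ∀ᵐ x ∂spaceMeasure, f x - (∫ t in (0 : ℝ)..x, g t) = r := ae_spaceMeasure_iff.2 hr
    have h2 : (fun x => F x - ∫ t in (0 : ℝ)..x, g t) =ᵐ[spaceMeasure] fun _ => r := by
      filter_upwards [h1, hfF] with x h1 h2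
      rw [← h2, h1]
    exact h2
  have hr0 : r = 0 := by
    have := hFV ⟨le_rfl, hπ.le⟩
    simpa [hF0] using this.symm
  have hFV' : ∀ x ∈ Icc 0 Real.pi, F x = ∫ t in (0 : ℝ)..x, g t := fun x hx => by
    have := hFV hx
    simp only [hr0] at this
    linarith
  refine ⟨_, hV, ?_, by simp, ?_⟩
  · filter_upwards [hfF, (ae_restrict_mem measurableSet_Ioo : ∀ᵐ x ∂spaceMeasure, _)]
      with x h1 h2
    rw [h1, hFV' x (Ioo_subset_Icc_self h2)]
  · rw [← hFV' _ ⟨hπ.le, le_rfl⟩, hFπ]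

/-! ### The Volterra operator and its compactness -/

/-- The Cauchy–Schwarz bound for the increments of a primitive. -/
theorem abs_integral_le_sqrt_mul_norm (f : L2) {x y : ℝ} (hx : x ∈ Icc 0 Real.pi)
    (hy : y ∈ Icc 0 Real.pi) : |∫ t in x..y, f t| ≤ √|y - x| * ‖f‖ := by
  wlog hxy : x ≤ y generalizing x y
  · rw [intervalIntegral.integral_symm, abs_neg, abs_sub_comm]
    exact this hy hx (le_of_not_ge hxy)
  have hμ : spaceMeasure (Ioc x y) ≠ ⊤ := measure_ne_top _ _
  have h1 := L2.inner_indicatorConstLp_one (𝕜 := ℝ) measurableSet_Ioc hμ f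
  have h2 (g : ℝ → ℝ) : ∫ t in Ioc x y, g t ∂spaceMeasure = ∫ t in x..y, g t := by
    rw [intervalIntegral.integral_of_le hxy, spaceMeasure, space, integral_Ioc_eq_integral_Ioo,
      Measure.restrict_restrict measurableSet_Ioo, integral_Ioc_eq_integral_Ioo,
      inter_eq_left.2 (Ioo_subset_Ioo hx.1 hy.2)]
  rw [← h2, ← h1]
  refine (abs_real_inner_le_norm _ _).trans ?_
  gcongr
  rw [norm_indicatorConstLp two_ne_zero ENNReal.ofNat_ne_top, norm_one, one_mul,
    Real.sqrt_eq_rpow, abs_of_nonneg (sub_nonneg.2 hxy), ENNReal.toReal_ofNat]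
  refine Real.rpow_le_rpow measureReal_nonneg ?_ (by positivity)
  have h3 : spaceMeasure.real (Ioc x y) ≤ volume.real (Ioc x y) :=
    ENNReal.toReal_mono (by simp) (Measure.restrict_apply_le _ _)
  rwa [Real.volume_real_Ioc_of_le hxy] at h3

theorem intervalIntegrable_coe (f : L2) {x : ℝ} (hx : x ∈ Icc 0 Real.pi) :
    IntervalIntegrable f volume 0 x :=
  ((Lp.memLp f).intervalIntegrable_space one_le_two).mono_set
    (by rw [uIcc_of_le hx.1, uIcc_of_le Real.pi_pos.le]; exact Icc_subset_Icc_right hx.2)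

theorem integral_congr_space {f g : ℝ → ℝ} (h : f =ᵐ[spaceMeasure] g) {x : ℝ}
    (hx : x ∈ Icc 0 Real.pi) : ∫ t in (0 : ℝ)..x, f t = ∫ t in (0 : ℝ)..x, g t := by
  rw [intervalIntegral.integral_of_le hx.1, intervalIntegral.integral_of_le hx.1,
    integral_Ioc_eq_integral_Ioo, integral_Ioc_eq_integral_Ioo]
  exact integral_congr_ae (ae_restrict_of_ae_restrict_of_subset (Ioo_subset_Ioo_right hx.2) h)

theorem L2.isPrim (f : L2) : IsPrim 0 Real.pi (fun x => ∫ t in (0 : ℝ)..x, f t) f :=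
  IsPrim.of_integral ((Lp.memLp f).intervalIntegrable_space one_le_two) ⟨le_rfl, Real.pi_pos.le⟩

/-- The Volterra operator on `L²(0, π)`. -/
noncomputable def volterra : L2 →L[ℝ] L2 :=
  LinearMap.mkContinuous
    { toFun := fun f => (L2.isPrim f).memLp_two.toLp _
      map_add' := fun f g => by
        rw [← MemLp.toLp_add]
        refine MemLp.toLp_congr _ _ (ae_spaceMeasure_iff.2 (Eventually.of_forall fun x hx => ?_))
        have hx' := Ioo_subset_Icc_self hx
        simp only [Pi.add_apply]
        rw [integral_congr_space (Lp.coeFn_add f g) hx']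
        exact intervalIntegral.integral_add (intervalIntegrable_coe f hx')
          (intervalIntegrable_coe g hx')
      map_smul' := fun r f => by
        rw [RingHom.id_apply, ← MemLp.toLp_const_smul]
        refine MemLp.toLp_congr _ _ (ae_spaceMeasure_iff.2 (Eventually.of_forall fun x hx => ?_))
        simp only [Pi.smul_apply]
        rw [integral_congr_space (Lp.coeFn_smul r f) (Ioo_subset_Icc_self hx)]
        exact intervalIntegral.integral_smul r f }
    ((measureUnivNNReal spaceMeasure : ℝ) ^ ((2 : ℝ≥0∞).toReal⁻¹) * √Real.pi) fun f => by
      rw [mul_assoc]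
      refine Lp.norm_le_of_ae_bound (by positivity) ?_
      filter_upwards [(L2.isPrim f).memLp_two.coeFn_toLp,
        (ae_restrict_mem measurableSet_Ioo : ∀ᵐ x ∂spaceMeasure, _)] with x h1 h2
      refine (congrArg norm h1).trans_le ?_
      refine (abs_integral_le_sqrt_mul_norm f ⟨le_rfl, Real.pi_pos.le⟩
        (Ioo_subset_Icc_self h2)).trans ?_
      gcongr
      rw [sub_zero, abs_of_pos h2.1]
      exact h2.2.le

theorem volterra_ae (f : L2) : volterra f =ᵐ[spaceMeasure] fun x => ∫ t in (0 : ℝ)..x, f t :=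
  MemLp.coeFn_toLp (L2.isPrim f).memLp_two

theorem norm_volterra_sub_le (f g : L2) {C : ℝ} (hC : 0 ≤ C)
    (h : ∀ x ∈ Icc 0 Real.pi, |(∫ t in (0 : ℝ)..x, f t) - ∫ t in (0 : ℝ)..x, g t| ≤ C) :
    ‖volterra f - volterra g‖ ≤
      (measureUnivNNReal spaceMeasure : ℝ) ^ ((2 : ℝ≥0∞).toReal⁻¹) * C := by
  refine Lp.norm_le_of_ae_bound hC ?_
  filter_upwards [volterra_ae f, volterra_ae g, Lp.coeFn_sub (volterra f) (volterra g),
    (ae_restrict_mem measurableSet_Ioo : ∀ᵐ x ∂spaceMeasure, _)] with x h1 h2 h3 h4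
  rw [h3, Pi.sub_apply, h1, h2]
  exact h x (Ioo_subset_Icc_self h4)

/-- Primitives of a bounded sequence are uniformly bounded and uniformly Hölder of exponent `1/2`,
so Arzelà–Ascoli gives a uniformly convergent subsequence, and uniform distance controls the `L²`
distance. -/
theorem volterra_compact (u : ℕ → L2) (hu : ∃ C, ∀ n, ‖u n‖ ≤ C) :
    ∃ ν : ℕ → ℕ, StrictMono ν ∧ CauchySeq (fun n => volterra (u (ν n))) := by
  obtain ⟨C, hC⟩ := hu
  have hC0 : 0 ≤ C := (norm_nonneg _).trans (hC 0)
  let V : ℕ → BoundedContinuousFunction (Icc 0 Real.pi) ℝ := fun n =>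
    BoundedContinuousFunction.mkOfCompact
      ⟨(Icc 0 Real.pi).domRestrict fun x => ∫ t in (0 : ℝ)..x, u n t,
        continuousOn_iff_continuous_domRestrict.1 ((L2.isPrim (u n)).continuousOn Real.pi_pos.le)⟩
  have hVapp : ∀ n x, V n x = ∫ t in (0 : ℝ)..x, u n t := fun n x => rfl
  have hinc : ∀ n (x y : Icc 0 Real.pi), dist (V n x) (V n y) ≤ √(dist x y) * C := by
    intro n x y
    rw [Real.dist_eq, hVapp, hVapp,
      intervalIntegral.integral_interval_sub_left (intervalIntegrable_coe _ x.2)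
        (intervalIntegrable_coe _ y.2)]
    refine (abs_integral_le_sqrt_mul_norm (u n) y.2 x.2).trans ?_
    rw [Subtype.dist_eq, Real.dist_eq]
    gcongr
    exact hC n
  have hK : IsCompact (closure (range V)) := by
    refine BoundedContinuousFunction.arzela_ascoli (Metric.closedBall 0 (√Real.pi * C))
      (isCompact_closedBall _ _) _ ?_ ?_
    · rintro _ x ⟨n, rfl⟩
      have h0 : V n ⟨0, le_rfl, Real.pi_pos.le⟩ = 0 := by simp [hVapp]
      have h1 := hinc n x ⟨0, le_rfl, Real.pi_pos.le⟩
      rw [h0] at h1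
      refine Metric.mem_closedBall.2 (h1.trans ?_)
      gcongr
      rw [Subtype.dist_eq, Real.dist_eq, sub_zero, abs_of_nonneg x.2.1]
      exact x.2.2
    · refine Metric.equicontinuous_of_continuity_modulus (fun t => √t * C) ?_ _ ?_
      · have : Continuous fun t : ℝ => √t * C := by fun_prop
        simpa using this.tendsto 0
      · rintro x y ⟨_, n, rfl⟩
        exact hinc n x y
  obtain ⟨_, -, ν, hν, hlim⟩ := hK.tendsto_subseq fun n => subset_closure (mem_range_self (f := V) n)
  refine ⟨ν, hν, ?_⟩
  have hcV := hlim.cauchySeq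
  set D := (measureUnivNNReal spaceMeasure : ℝ) ^ ((2 : ℝ≥0∞).toReal⁻¹) with hD
  have hD0 : 0 ≤ D := by positivity
  rw [Metric.cauchySeq_iff] at hcV ⊢
  intro ε hε
  obtain ⟨N, hN⟩ := hcV (ε / (D + 1)) (by positivity)
  refine ⟨N, fun m hm n hn => ?_⟩
  rw [dist_eq_norm]
  have h1 := norm_volterra_sub_le (u (ν m)) (u (ν n)) (C := dist (V (ν m)) (V (ν n))) dist_nonneg
    fun x hx => BoundedContinuousFunction.dist_coe_le_dist (f := V (ν m)) (g := V (ν n)) ⟨x, hx⟩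
  have h2 := hN m hm n hn
  simp only [Function.comp_apply] at h2
  rw [lt_div_iff₀ (by positivity)] at h2
  nlinarith [dist_nonneg (x := V (ν m)) (y := V (ν n))]

/-! ### Multiplication operators and division by the coefficient -/

/-- Multiplication by a bounded function, as an operator on `L²(0, π)`. -/
noncomputable def mulOp {g : ℝ → ℝ} (hg : MemLp g ⊤ spaceMeasure) : L2 →L[ℝ] L2 :=
  (ContinuousLinearMap.mul ℝ ℝ).holderL spaceMeasure ⊤ 2 2 (hg.toLp g)

theorem mulOp_ae {g : ℝ → ℝ} (hg : MemLp g ⊤ spaceMeasure) (f : L2) :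
    mulOp hg f =ᵐ[spaceMeasure] fun x => g x * f x := by
  have h := (ContinuousLinearMap.mul ℝ ℝ).coeFn_holder (r := 2) (hg.toLp g) f
  filter_upwards [h, hg.coeFn_toLp] with x h1 h2
  rw [← h2]
  exact h1

theorem inner_L2_eq (f g : L2) : ⟪f, g⟫_ℝ = ∫ x in space, f x * g x := by
  rw [L2.inner_def]
  refine integral_congr_ae (Eventually.of_forall fun x => ?_)
  simp [mul_comm]

theorem inner_mulOp {g : ℝ → ℝ} (hg : MemLp g ⊤ spaceMeasure) (f k : L2) :
    ⟪mulOp hg f, k⟫_ℝ = ∫ x in space, g x * f x * k x := by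
  rw [inner_L2_eq]
  refine integral_congr_ae ?_
  filter_upwards [mulOp_ae hg f] with x hx
  rw [hx]

theorem mulOp_symm {g : ℝ → ℝ} (hg : MemLp g ⊤ spaceMeasure) (f k : L2) :
    ⟪mulOp hg f, k⟫_ℝ = ⟪f, mulOp hg k⟫_ℝ := by
  rw [real_inner_comm _ f, inner_mulOp, inner_mulOp]
  congr 1; ext x; ring

theorem L2.integrable_mul (f g : L2) :
    Integrable (fun x => f x * g x) (volume.restrict space) :=
  (Lp.memLp f).integrable_mul (Lp.memLp g)

theorem mul_norm_sq_le_inner_mulOp {g : ℝ → ℝ} (hg : MemLp g ⊤ spaceMeasure) {c : ℝ}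
    (hc : ∀ᵐ x ∂spaceMeasure, c ≤ g x) (f : L2) : c * ‖f‖ ^ 2 ≤ ⟪mulOp hg f, f⟫_ℝ := by
  rw [← real_inner_self_eq_norm_sq, inner_L2_eq, inner_L2_eq, ← integral_const_mul]
  refine integral_mono_ae ((L2.integrable_mul f f).const_mul c) (L2.integrable_mul _ f) ?_
  filter_upwards [mulOp_ae hg f, hc] with x h1 h2
  rw [h1, mul_assoc]
  exact mul_le_mul_of_nonneg_right h2 (mul_self_nonneg _)

theorem IsPrim.memLp_space {u u' : ℝ → ℝ} (hu : IsPrim 0 Real.pi u u') :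
    MemLp u ⊤ spaceMeasure := hu.memLp_top Real.pi_pos.le

/-- The quotient of a bounded function by a coefficient bounded below. -/
theorem memLp_top_div {f γ : ℝ → ℝ} {c : ℝ} (hf : MemLp f ⊤ spaceMeasure)
    (hγ : MemLp γ ⊤ spaceMeasure) (hc : 0 < c) (hcγ : ∀ᵐ x ∂spaceMeasure, c ≤ γ x) :
    MemLp (fun x => f x / γ x) ⊤ spaceMeasure := by
  have h1 : MemLp (fun x => (γ x)⁻¹) ⊤ spaceMeasure := by
    refine memLp_top_of_bound hγ.1.aemeasurable.inv.aestronglyMeasurable c⁻¹ ?_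
    filter_upwards [hcγ] with x hx
    rw [norm_inv, Real.norm_eq_abs, abs_of_pos (hc.trans_le hx)]
    gcongr
  simpa only [div_eq_mul_inv] using h1.mul' (r := ⊤) hf

/-! ### Existence of an eigenfunction -/

/-- An eigenfunction `φ` of `-(γ φ')' + γ₀ φ` for the eigenvalue `l`, with its flux `P = γ φ'`. -/
structure IsEigenpair (γ γ₀ : ℝ → ℝ) (l : ℝ) (φ P : ℝ → ℝ) : Prop where
  prim : IsPrim 0 Real.pi φ fun x => P x / γ x
  flux : IsPrim 0 Real.pi P fun x => (γ₀ x - l) * φ x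
  left : φ 0 = 0
  right : φ Real.pi = 0
  norm : ∫ x in space, φ x ^ 2 = 1

/-- The unknown is the derivative `f = φ'`, an `L²` function of mean zero. The Euler equation says
that `γ f` minus a primitive of `(γ₀ - l) φ` is orthogonal to all functions of mean zero, hence
constant, which yields an absolutely continuous flux. -/
theorem exists_eigenpair {γ γ₀ : ℝ → ℝ}
    (hγ : MemLp γ ⊤ spaceMeasure) (hγ₀ : MemLp γ₀ ⊤ spaceMeasure) {c : ℝ} (hc : 0 < c)
    (hcγ : ∀ᵐ x ∂spaceMeasure, c ≤ γ x) : ∃ l φ P, IsEigenpair γ γ₀ l φ P := by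
  have hπ := Real.pi_pos
  let one : L2 := (memLp_const (1 : ℝ)).toLp _
  have hone : one =ᵐ[spaceMeasure] fun _ => 1 := (memLp_const (1 : ℝ)).coeFn_toLp
  have hmean : ∀ f : L2, ⟪one, f⟫_ℝ = ∫ x in (0 : ℝ)..Real.pi, f x := by
    intro f
    rw [inner_L2_eq, ← integral_space_eq]
    refine integral_congr_ae ?_
    filter_upwards [hone] with x hx
    rw [hx, one_mul]
  -- Mean zero is the condition that the primitive from `0` also vanishes at `π`.
  let K : Submodule ℝ L2 := (ℝ ∙ one)ᗮ
  have hKmem : ∀ f, f ∈ K ↔ ∫ x in (0 : ℝ)..Real.pi, f x = 0 := fun f => by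
    rw [Submodule.mem_orthogonal_singleton_iff_inner_right, hmean]
  let A := volterra
  -- The quadratic form of `T` is the energy `∫ (γ φ'² + γ₀ φ²)` written in terms of `f = φ'`.
  let T : L2 →L[ℝ] L2 :=
    mulOp hγ + (ContinuousLinearMap.adjoint A).comp ((mulOp hγ₀).comp A)
  have hTin : ∀ f g, ⟪T f, g⟫_ℝ = ⟪mulOp hγ f, g⟫_ℝ + ⟪mulOp hγ₀ (A f), A g⟫_ℝ := by
    intro f g
    simp only [T, add_apply, ContinuousLinearMap.comp_apply, inner_add_left,
      ContinuousLinearMap.adjoint_inner_left]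
  have hTsymm : ∀ f g, ⟪T f, g⟫_ℝ = ⟪f, T g⟫_ℝ := by
    intro f g
    rw [real_inner_comm (T g), hTin, hTin, mulOp_symm, mulOp_symm hγ₀, real_inner_comm,
      real_inner_comm (A f)]
  set M := ‖mulOp hγ₀‖ with hM
  have hcoer : ∀ f, c * ‖f‖ ^ 2 ≤ ⟪T f, f⟫_ℝ + M * ‖A f‖ ^ 2 := by
    intro f
    have h1 := mul_norm_sq_le_inner_mulOp hγ hcγ f
    have h2 : |⟪mulOp hγ₀ (A f), A f⟫_ℝ| ≤ M * ‖A f‖ ^ 2 := by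
      refine (abs_real_inner_le_norm _ _).trans ?_
      rw [sq, ← mul_assoc]
      gcongr
      exact (mulOp hγ₀).le_opNorm _
    rw [hTin]
    linarith [(abs_le.1 h2).1]
  have hKA : ∃ f ∈ K, A f ≠ 0 := by
    have hcos : MemLp Real.cos 2 spaceMeasure :=
      (IsPrim.of_contDiff Real.contDiff_cos).memLp_two
    have hcosl : hcos.toLp =ᵐ[spaceMeasure] Real.cos := hcos.coeFn_toLp
    -- The cosine has mean zero, and its primitive, the sine, is positive on `(0, π)`.
    refine ⟨hcos.toLp, (hKmem _).2 ?_, fun h0 => ?_⟩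
    · rw [integral_congr_space hcosl ⟨hπ.le, le_rfl⟩, integral_cos]
      simp
    · have h1 := volterra_ae hcos.toLp
      have h2 : (A hcos.toLp : ℝ → ℝ) =ᵐ[spaceMeasure] 0 := by
        rw [h0]
        exact Lp.coeFn_zero _ _ _
      have hne : (ae spaceMeasure).NeBot := by
        rw [ae_neBot, spaceMeasure, Ne, Measure.restrict_eq_zero, space, Real.volume_Ioo]
        simpa using hπ
      obtain ⟨x, h1, h2, h3⟩ := (h1.and (h2.and
        (ae_restrict_mem measurableSet_Ioo : ∀ᵐ x ∂spaceMeasure, x ∈ Ioo 0 Real.pi))).exists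
      rw [h2, Pi.zero_apply] at h1
      simp only at h1
      rw [integral_congr_space hcosl (Ioo_subset_Icc_self h3),
        integral_cos, Real.sin_zero, sub_zero] at h1
      exact (Real.sin_pos_of_pos_of_lt_pi h3.1 h3.2).ne h1
  obtain ⟨l, f, hfK, hAf, hEuler⟩ := exists_weak_eigenvector T hTsymm A K
    (Submodule.isClosed_orthogonal _) hc hcoer volterra_compact hKA
  set φ : ℝ → ℝ := fun x => ∫ t in (0 : ℝ)..x, f t with hφ
  have hφf : IsPrim 0 Real.pi φ f := L2.isPrim f
  have hAφ : A f =ᵐ[spaceMeasure] φ := volterra_ae f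
  have hgm : MemLp (fun x => (γ₀ x - l) * φ x) ⊤ spaceMeasure :=
    hφf.memLp_space.mul' (hγ₀.sub (memLp_const l))
  have hG : IsPrim 0 Real.pi (fun x => ∫ t in (0 : ℝ)..x, (γ₀ t - l) * φ t)
      (fun x => (γ₀ x - l) * φ x) :=
    IsPrim.of_integral (hgm.intervalIntegrable_space le_top) ⟨le_rfl, hπ.le⟩
  set G : ℝ → ℝ := fun x => ∫ t in (0 : ℝ)..x, (γ₀ t - l) * φ t with hGdef
  let Gl : L2 := hG.memLp_two.toLp G
  have hGl : Gl =ᵐ[spaceMeasure] G := hG.memLp_two.coeFn_toLp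
  -- The flux differs from `G` by a constant, being orthogonal to all functions of mean zero.
  let D : L2 := mulOp hγ f - Gl
  have hDK : ∀ η ∈ K, ⟪D, η⟫_ℝ = 0 := by
    intro η hη
    have h1 := hEuler η hη
    have hηp := L2.isPrim η
    have h2 := hG.integral_mul_add hηp hπ.le
    simp only [(hKmem η).1 hη, mul_zero, intervalIntegral.integral_same, sub_zero] at h2
    rw [intervalIntegral.integral_add, ← integral_space_eq, ← integral_space_eq] at h2
    · have h3 : ⟪Gl, η⟫_ℝ = ∫ x in space, G x * η x := by
        rw [inner_L2_eq]
        refine integral_congr_ae ?_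
        filter_upwards [hGl] with x hx
        rw [hx]
      have h4 : ⟪mulOp hγ₀ (A f), A η⟫_ℝ - l * ⟪A f, A η⟫_ℝ =
          ∫ x in space, (γ₀ x - l) * φ x * ∫ t in (0 : ℝ)..x, η t := by
        rw [inner_L2_eq, inner_L2_eq, ← integral_const_mul,
          ← integral_sub (L2.integrable_mul _ _) ((L2.integrable_mul _ _).const_mul l)]
        refine integral_congr_ae ?_
        filter_upwards [mulOp_ae hγ₀ (A f), hAφ, volterra_ae η] with x e1 e2 e3
        rw [e1, e3, e2]
        ring
      rw [hTin] at h1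
      simp only [D, inner_sub_left]
      linarith
    · exact (hG.intervalIntegrable hπ.le).mul_continuousOn
        (by rw [uIcc_of_le hπ.le]; exact hηp.continuousOn hπ.le)
    · exact (hηp.intervalIntegrable hπ.le).continuousOn_mul
        (by rw [uIcc_of_le hπ.le]; exact hG.continuousOn hπ.le)
  have hDc : ∃ r : ℝ, r • one = D := by
    have h1 : D ∈ (ℝ ∙ one)ᗮᗮ := (Submodule.mem_orthogonal' _ _).2 hDK
    rw [Submodule.orthogonal_orthogonal] at h1
    exact Submodule.mem_span_singleton.1 h1
  obtain ⟨r, hr⟩ := hDc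
  have hP : IsPrim 0 Real.pi (fun x => r + G x) (fun x => (γ₀ x - l) * φ x) := by
    simpa using (IsPrim.const r).add hG
  have hflux : ∀ᵐ x ∂spaceMeasure, f x = (r + G x) / γ x := by
    have h1 : D =ᵐ[spaceMeasure] fun _ => r := by
      rw [← hr]
      filter_upwards [Lp.coeFn_smul r one, hone] with x h1 h2
      rw [h1, Pi.smul_apply, h2, smul_eq_mul, mul_one]
    filter_upwards [h1, Lp.coeFn_sub (mulOp hγ f) Gl, mulOp_ae hγ f, hGl, hcγ]
      with x h1 h2 h3 h4 h5
    rw [h2, Pi.sub_apply, h3, h4] at h1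
    rw [eq_div_iff (hc.trans_le h5).ne']
    linarith
  refine ⟨l, φ, fun x => r + G x, hφf.congr_deriv (ae_spaceMeasure_iff.1 hflux), hP, by simp [hφ],
    (hKmem f).1 hfK, ?_⟩
  have h1 : ‖A f‖ ^ 2 = 1 := by rw [hAf, one_pow]
  rw [← h1, ← real_inner_self_eq_norm_sq, inner_L2_eq]
  refine integral_congr_ae ?_
  filter_upwards [hAφ] with x hx
  rw [hx, sq]

theorem IsEigenpair.neg {γ γ₀ : ℝ → ℝ} {l : ℝ} {φ P : ℝ → ℝ} (h : IsEigenpair γ γ₀ l φ P) :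
    IsEigenpair γ γ₀ l (fun x => -1 * φ x) (fun x => -1 * P x) where
  prim := (h.prim.const_mul (-1)).congr_deriv (Eventually.of_forall fun x _ => by ring)
  flux := (h.flux.const_mul (-1)).congr_deriv (Eventually.of_forall fun x _ => by ring)
  left := by rw [h.left, mul_zero]
  right := by rw [h.right, mul_zero]
  norm := by simpa using h.norm

theorem IsEigenpair.exists_pos {γ γ₀ : ℝ → ℝ} {l : ℝ} {φ P : ℝ → ℝ}
    (h : IsEigenpair γ γ₀ l φ P) :
    ∃ φ P, IsEigenpair γ γ₀ l φ P ∧ ∃ x ∈ Ioo 0 Real.pi, 0 < φ x := by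
  have h1 : ∃ x ∈ Ioo 0 Real.pi, φ x ≠ 0 := by
    by_contra! h0
    have := h.norm
    rw [setIntegral_eq_zero_of_forall_eq_zero (t := space) fun x hx => by rw [h0 x hx]; ring]
      at this
    exact zero_ne_one this
  obtain ⟨x, hx, hφx⟩ := h1
  rcases hφx.lt_or_gt with h2 | h2
  · exact ⟨_, _, h.neg, x, hx, by linarith⟩
  · exact ⟨φ, P, h, x, hx, h2⟩

/-! ### A cut-off with transition layers orthogonal to the eigenfunction -/

/-- The last point before `x` at which a continuous function takes the value `m`. -/
theorem exists_last_crossing {f : ℝ → ℝ} {x m : ℝ} (hx : 0 ≤ x) (hf : ContinuousOn f (Icc 0 x))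
    (h0 : f 0 ≤ m) (hm : m < f x) :
    ∃ α, 0 ≤ α ∧ α < x ∧ f α = m ∧ ∀ y ∈ Icc α x, m ≤ f y := by
  have hc : IsCompact (Icc 0 x ∩ f ⁻¹' {m}) :=
    isCompact_Icc.of_isClosed_subset
      (hf.preimage_isClosed_of_isClosed isClosed_Icc isClosed_singleton) inter_subset_left
  obtain ⟨z, hz, hzm⟩ := intermediate_value_Icc hx hf ⟨h0, hm.le⟩
  obtain ⟨α, ⟨hα, hαm⟩, hmax⟩ := hc.exists_isGreatest ⟨z, hz, hzm⟩
  have hαm : f α = m := hαm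
  refine ⟨α, hα.1, lt_of_le_of_ne hα.2 (by rintro rfl; exact hm.ne' hαm), hαm, fun y hy => ?_⟩
  by_contra hlt
  push Not at hlt
  have hyx : Icc y x ⊆ Icc 0 x := Icc_subset_Icc_left (hα.1.trans hy.1)
  obtain ⟨t, ht, htm⟩ := intermediate_value_Icc hy.2 (hf.mono hyx) ⟨hlt.le, hm.le⟩
  have h1 : t ≤ α := hmax ⟨hyx ht, htm⟩
  have h2 : y = α := le_antisymm (ht.1.trans h1) hy.1
  rw [h2, hαm] at hlt
  exact lt_irrefl _ hlt

/-- Around a point of positivity, a continuous function vanishing at the end points of `[0, L]` is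
bounded below on an interval `[α, β]` containing a shorter one `[a, b]`, and constant neither on
`[α, a]` nor on `[b, β]`. -/
theorem exists_nested_intervals {f : ℝ → ℝ} {L x : ℝ} (hf : ContinuousOn f (Icc 0 L))
    (h0 : f 0 = 0) (hL : f L = 0) (hx : x ∈ Ioo 0 L) (hfx : 0 < f x) :
    ∃ m α a b β, 0 < m ∧ 0 ≤ α ∧ α < a ∧ a < b ∧ b < β ∧ β ≤ L ∧
      (∀ y ∈ Icc α β, m ≤ f y) ∧ f α ≠ f a ∧ f b ≠ f β := by
  set m := f x / 2 with hm
  have hmx : m < f x := by linarith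
  have hm0 : 0 < m := by linarith
  obtain ⟨α, hα0, hαx, hαm, hα⟩ := exists_last_crossing hx.1.le
    (hf.mono (Icc_subset_Icc_right hx.2.le)) (h0.trans_le hm0.le) hmx
  -- The right end point is obtained by reflecting the interval.
  obtain ⟨β', hβ0, hβx, hβm, hβ⟩ := exists_last_crossing (f := fun y => f (L - y)) (x := L - x)
    (m := m) (sub_nonneg.2 hx.2.le)
    (hf.comp (by fun_prop) fun y hy => ⟨by linarith [hy.2, hx.1], by linarith [hy.1]⟩)
    (by simpa [hL] using hm0.le) (by simpa using hmx)
  have hcont : ContinuousAt f x := hf.continuousAt (Icc_mem_nhds hx.1 hx.2)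
  have hev : ∀ᶠ y in 𝓝 x, m < f y := hcont.eventually_const_lt hmx
  obtain ⟨a, ⟨hma, hαa⟩, hax⟩ := (((hev.and (Ioi_mem_nhds hαx)).filter_mono
    (nhdsWithin_le_nhds (s := Iio x))).and self_mem_nhdsWithin).exists
  -- Here `b = x`, and `a` lies just left of it. Since `f` equals `m` at `α` and `β` but exceeds `m`
  -- at `a` and `b`, neither layer sees a constant.
  refine ⟨m, α, a, x, L - β', hm0, hα0, hαa, hax, by linarith, by linarith, fun y hy => ?_,
    ?_, ?_⟩
  · rcases le_total y x with h | h
    · exact hα y ⟨hy.1, h⟩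
    · simpa using hβ (L - y) ⟨by linarith [hy.2], by linarith⟩
  · rw [hαm]; exact hma.ne
  · rw [hβm]; exact hmx.ne'

/-- A profile with unit mass, orthogonal to a given nonconstant function. -/
theorem exists_affine_profile {f : ℝ → ℝ} {c d : ℝ} (hcd : c < d) (hf : ContinuousOn f (Icc c d))
    (hne : f c ≠ f d) : ∃ r s : ℝ, (∫ x in c..d, (r + s * f x)) = 1 ∧
      (∫ x in c..d, f x * (r + s * f x)) = 0 := by
  have hi1 : IntervalIntegrable f volume c d :=
    ContinuousOn.intervalIntegrable (by rwa [uIcc_of_le hcd.le])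
  have hi2 : IntervalIntegrable (fun x => f x ^ 2) volume c d :=
    ContinuousOn.intervalIntegrable (by rw [uIcc_of_le hcd.le]; exact hf.pow 2)
  set M1 := ∫ x in c..d, f x with hM1
  set M2 := ∫ x in c..d, f x ^ 2 with hM2
  have hI1 : ∀ r s : ℝ, (∫ x in c..d, (r + s * f x)) = (d - c) * r + s * M1 := by
    intro r s
    rw [intervalIntegral.integral_add intervalIntegrable_const (hi1.const_mul s)]
    simp [hM1]
  have hI2 : ∀ r s : ℝ, (∫ x in c..d, f x * (r + s * f x)) = r * M1 + s * M2 := by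
    intro r s
    rw [hM1, hM2, ← intervalIntegral.integral_const_mul, ← intervalIntegral.integral_const_mul,
      ← intervalIntegral.integral_add (hi1.const_mul r) (hi2.const_mul s)]
    congr 1; ext x; ring
  have hpos : ∀ r : ℝ, 0 < ∫ x in c..d, (f x - r) ^ 2 := by
    intro r
    refine intervalIntegral.integral_pos hcd ((hf.sub continuousOn_const).pow 2)
      (fun x _ => sq_nonneg _) ?_
    by_cases h : f c = r
    · exact ⟨d, ⟨hcd.le, le_rfl⟩, by
        have : f d - r ≠ 0 := sub_ne_zero.2 fun h' => hne (h.trans h'.symm)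
        positivity⟩
    · exact ⟨c, ⟨le_rfl, hcd.le⟩, by
        have : f c - r ≠ 0 := sub_ne_zero.2 h
        positivity⟩
  have hexp : ∀ r : ℝ, ∫ x in c..d, (f x - r) ^ 2 = M2 - 2 * r * M1 + (d - c) * r ^ 2 := by
    intro r
    have h1 : ∀ x, (f x - r) ^ 2 = f x ^ 2 + (r ^ 2 + -(2 * r) * f x) := fun x => by ring
    simp only [h1]
    rw [intervalIntegral.integral_add hi2
      (intervalIntegrable_const.add (hi1.const_mul _)), hI1]
    ring
  have hdc : 0 < d - c := sub_pos.2 hcd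
  -- The Gram determinant of `1` and `f`, positive by strict Cauchy–Schwarz; `r` and `s` below solve
  -- the linear system by Cramer's rule.
  set Δ := (d - c) * M2 - M1 ^ 2 with hΔ
  have hΔ0 : 0 < Δ := by
    have h1 := hpos (M1 / (d - c))
    rw [hexp] at h1
    have h2 : (M2 - 2 * (M1 / (d - c)) * M1 + (d - c) * (M1 / (d - c)) ^ 2) * (d - c) = Δ := by
      field_simp; ring
    rw [← h2]
    positivity
  refine ⟨M2 / Δ, -M1 / Δ, ?_, ?_⟩
  · rw [hI1]; field_simp; rw [hΔ]; ring
  · rw [hI2]; field_simp; ring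

theorem integral_indicator_Ioc_of_le {c d x : ℝ} (s : ℝ → ℝ) (hx : 0 ≤ x) (hxc : x ≤ c) :
    ∫ t in (0 : ℝ)..x, (Ioc c d).indicator s t = 0 := by
  rw [intervalIntegral.integral_of_le hx]
  refine setIntegral_eq_zero_of_forall_eq_zero fun t ht => indicator_of_notMem ?_ _
  exact fun h => absurd h.1 (not_lt.2 (ht.2.trans hxc))

theorem integral_indicator_Ioc_of_ge {c d x : ℝ} (s : ℝ → ℝ) (hc : 0 ≤ c) (hcd : c ≤ d)
    (hdx : d ≤ x) : ∫ t in (0 : ℝ)..x, (Ioc c d).indicator s t = ∫ t in c..d, s t := by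
  rw [intervalIntegral.integral_of_le (hc.trans (hcd.trans hdx)),
    setIntegral_indicator measurableSet_Ioc, inter_eq_right.2 (Ioc_subset_Ioc hc hdx),
    intervalIntegral.integral_of_le hcd]

/-- The derivative `w` of a cut-off function equal to `1` on `[a, b]` and supported in `[α, β]`,
such that both transition layers are orthogonal to `f`. -/
theorem exists_cutoff {f : ℝ → ℝ} {L α a b β : ℝ} (hf : ContinuousOn f (Icc 0 L)) (hα : 0 ≤ α)
    (hαa : α < a) (hab : a < b) (hbβ : b < β) (hβ : β ≤ L) (hfα : f α ≠ f a) (hfβ : f b ≠ f β) :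
    ∃ w : ℝ → ℝ, MemLp w ⊤ (volume.restrict (Ioo 0 L)) ∧ (∀ x, x ∉ Icc α β → w x = 0) ∧
      (∀ x ∈ Icc a b, ∫ t in (0 : ℝ)..x, w t = 1) ∧
      (∀ x ∈ Icc 0 L, x ∉ Icc α β → ∫ t in (0 : ℝ)..x, w t = 0) ∧
      (∀ x ∈ Icc a b, ∫ t in (0 : ℝ)..x, f t * w t = 0) ∧
      (∀ x ∈ Icc 0 L, x ∉ Icc α β → ∫ t in (0 : ℝ)..x, f t * w t = 0) ∧
      (∫ t in (0 : ℝ)..L, f t * w t = 0) := by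
  obtain ⟨r, s, h1, h2⟩ := exists_affine_profile hαa
    (hf.mono (Icc_subset_Icc hα (by linarith))) hfα
  obtain ⟨r', s', h1', h2'⟩ := exists_affine_profile hbβ
    (hf.mono (Icc_subset_Icc (by linarith) hβ)) hfβ
  have key : ∀ g g' : ℝ → ℝ, ContinuousOn g (Icc 0 L) → ContinuousOn g' (Icc 0 L) →
      ∀ i i' : ℝ, (∫ x in α..a, g x) = i → (∫ x in b..β, g' x) = i' →
      (∀ x ∈ Icc a b, ∫ t in (0 : ℝ)..x,
        ((Ioc α a).indicator g t - (Ioc b β).indicator g' t) = i) ∧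
      (∀ x, 0 ≤ x → x ≤ α → ∫ t in (0 : ℝ)..x,
        ((Ioc α a).indicator g t - (Ioc b β).indicator g' t) = 0) ∧
      (∀ x, β ≤ x → x ≤ L → ∫ t in (0 : ℝ)..x,
        ((Ioc α a).indicator g t - (Ioc b β).indicator g' t) = i - i') := by
    intro g g' hg hg' i i' hi hi'
    have hint : ∀ (k : ℝ → ℝ) (c d x : ℝ), ContinuousOn k (Icc 0 L) → 0 ≤ x → x ≤ L →
        IntervalIntegrable ((Ioc c d).indicator k) volume 0 x := by
      intro k c d x hk hx hxL
      rw [intervalIntegrable_iff_integrableOn_Ioc_of_le hx]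
      exact (((hk.integrableOn_Icc).mono_set
        (Ioc_subset_Icc_self.trans (Icc_subset_Icc_right hxL)))).indicator measurableSet_Ioc
    refine ⟨fun x hx => ?_, fun x hx hxα => ?_, fun x hx hxL => ?_⟩
    · have hx0 : 0 ≤ x := by linarith [hx.1]
      have hxL : x ≤ L := by linarith [hx.2]
      rw [intervalIntegral.integral_sub (hint g _ _ x hg hx0 hxL) (hint g' _ _ x hg' hx0 hxL),
        integral_indicator_Ioc_of_ge g hα hαa.le hx.1, integral_indicator_Ioc_of_le g' hx0 hx.2,
        hi, sub_zero]
    · have hxL : x ≤ L := by linarith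
      rw [intervalIntegral.integral_sub (hint g _ _ x hg hx hxL) (hint g' _ _ x hg' hx hxL),
        integral_indicator_Ioc_of_le g hx hxα,
        integral_indicator_Ioc_of_le g' hx (by linarith), sub_zero]
    · have hx0 : 0 ≤ x := by linarith
      rw [intervalIntegral.integral_sub (hint g _ _ x hg hx0 hxL) (hint g' _ _ x hg' hx0 hxL),
        integral_indicator_Ioc_of_ge g hα hαa.le (by linarith),
        integral_indicator_Ioc_of_ge g' (by linarith) hbβ.le hx, hi, hi']
  have hp : ContinuousOn (fun x => r + s * f x) (Icc 0 L) :=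
    continuousOn_const.add (continuousOn_const.mul hf)
  have hp' : ContinuousOn (fun x => r' + s' * f x) (Icc 0 L) :=
    continuousOn_const.add (continuousOn_const.mul hf)
  have hbdd : ∀ (k : ℝ → ℝ) (c d : ℝ), ContinuousOn k (Icc 0 L) →
      MemLp ((Ioc c d).indicator k) ⊤ (volume.restrict (Ioo 0 L)) := by
    intro k c d hk
    obtain ⟨C, hC⟩ := isCompact_Icc.exists_bound_of_continuousOn hk
    refine MemLp.indicator measurableSet_Ioc (memLp_top_of_bound ((hk.mono
      Ioo_subset_Icc_self).aestronglyMeasurable measurableSet_Ioo) C ?_)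
    filter_upwards [ae_restrict_mem measurableSet_Ioo] with x hx
    exact hC x (Ioo_subset_Icc_self hx)
  obtain ⟨k1, k2, k3⟩ := key _ _ hp hp' 1 1 h1 h1'
  obtain ⟨l1, l2, l3⟩ := key (fun x => f x * (r + s * f x))
    (fun x => f x * (r' + s' * f x)) (hf.mul hp) (hf.mul hp') 0 0 h2 h2'
  -- The cut-off rises by one on `(α, a]` and falls by one on `(b, β]`.
  set w : ℝ → ℝ := fun t => (Ioc α a).indicator (fun x => r + s * f x) t -
    (Ioc b β).indicator (fun x => r' + s' * f x) t with hw
  have hfw : ∀ t, f t * w t = (Ioc α a).indicator (fun x => f x * (r + s * f x)) t -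
      (Ioc b β).indicator (fun x => f x * (r' + s' * f x)) t := by
    intro t
    simp only [hw, indicator_apply]
    split_ifs <;> ring
  have hsplit : ∀ x, x ∉ Icc α β → x ≤ α ∨ β ≤ x := by
    intro x hx
    by_contra! h
    exact hx ⟨h.1.le, h.2.le⟩
  refine ⟨w, (hbdd _ _ _ hp).sub (hbdd _ _ _ hp'), fun x hx => ?_, k1, fun x hx hxn => ?_, ?_⟩
  · simp only [hw]
    rw [indicator_of_notMem fun h => hx ⟨h.1.le, by linarith [h.2]⟩,
      indicator_of_notMem fun h => hx ⟨by linarith [h.1], h.2⟩, sub_zero]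
  · rcases hsplit x hxn with h | h
    · exact k2 x hx.1 h
    · rw [k3 x h hx.2, sub_self]
  · simp only [hfw]
    refine ⟨l1, fun x hx hxn => ?_, ?_⟩
    · rcases hsplit x hxn with h | h
      · exact l2 x hx.1 h
      · rw [l3 x h hx.2, sub_self]
    · rw [l3 L hβ le_rfl, sub_self]

/-! ### Unobservable modes obstruct controllability -/

/-- `(φ₁, φ)` is an eigenvector of the adjoint of the cascade system, `φ₁` vanishing on `O`;
`R` is the flux `γ φ₁' + p φ`. -/
structure IsUnobservable (γ γ₀ p : ℝ → ℝ) (O : Set ℝ) (l : ℝ) (φ φ₁ φ₁' R : ℝ → ℝ) : Prop where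
  prim : IsPrim 0 Real.pi φ₁ φ₁'
  bounded : MemLp φ₁' ⊤ spaceMeasure
  left : φ₁ 0 = 0
  right : φ₁ Real.pi = 0
  vanish : ∀ x ∈ O, φ₁ x = 0
  flux : IsPrim 0 Real.pi R fun x => (γ₀ x - l) * φ₁ x
  flux_eq : ∀ᵐ x ∂spaceMeasure, R x = γ x * φ₁' x + p x * φ x

/-- Testing an equation in flux form `R' = (γ₀ - l) v` against `H¹₀(0, π)`. -/
theorem CascadeControl.IsH10.integral_flux_eq {γ₀ R v u z : ℝ → ℝ} {l : ℝ} (hu : IsH10 u z)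
    (hR : IsPrim 0 Real.pi R fun x => (γ₀ x - l) * v x) :
    ∫ x in space, (R x * z x + (γ₀ x - l) * v x * u x) = 0 := by
  obtain ⟨U, hU, huU, hU0, hUπ⟩ := hu.exists_isPrim
  have h := hR.integral_mul_add hU Real.pi_pos.le
  rw [hU0, hUπ, mul_zero, mul_zero, sub_zero, ← integral_space_eq] at h
  rw [← h]
  refine integral_congr_ae ?_
  filter_upwards [huU] with x hx
  rw [hx]
  ring

theorem integral_coe_mul_toLp (f : L2) {g : ℝ → ℝ} (hg : MemLp g 2 spaceMeasure) :
    ∫ x in space, f x * g x = ⟪f, hg.toLp⟫_ℝ := by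
  rw [inner_L2_eq]
  refine integral_congr_ae ?_
  filter_upwards [hg.coeFn_toLp] with x hx
  rw [hx]

theorem integrable_mul_mul {g h : ℝ → ℝ} (hg : MemLp g ⊤ spaceMeasure)
    (hh : MemLp h ⊤ spaceMeasure) (f : L2) :
    Integrable (fun x => g x * f x * h x) (volume.restrict space) := by
  have h1 : MemLp (fun x => f x * h x) 2 spaceMeasure := hh.mul' (Lp.memLp f)
  have h2 : MemLp (fun x => g x * (f x * h x)) 2 spaceMeasure := h1.mul' hg
  refine (h2.integrable one_le_two).congr (Eventually.of_forall fun x => ?_)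
  simp only [mul_assoc]

/-- Testing the first equation with `φ₁` and the second with `φ` produces the coupling integral `J`
with opposite signs, while the control term dies because `φ₁` vanishes on `O`. What remains is the
integral form of `F' = -l F` for the pairing `F`. -/
theorem IsUnobservable.evolution {γ γ₀ p : ℝ → ℝ} {O : Set ℝ} {l : ℝ} {φ P φ₁ φ₁' R : ℝ → ℝ}
    (hφ : IsEigenpair γ γ₀ l φ P) (h : IsUnobservable γ γ₀ p O l φ φ₁ φ₁' R)
    (hγ : MemLp γ ⊤ spaceMeasure) (hγ₀ : MemLp γ₀ ⊤ spaceMeasure) {c : ℝ} (hc : 0 < c)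
    (hcγ : ∀ᵐ x ∂spaceMeasure, c ≤ γ x) (hp : MemLp p ⊤ spaceMeasure)
    {T : ℝ} (hT : 0 < T) {y0 : State} {v : ℝ × ℝ → ℝ} {y : ℝ → State}
    (hy : IsSolution γ γ₀ p (fun _ => 0) O T y0 v y) :
    ⟪y T, WithLp.toLp 2 (h.prim.memLp_two.toLp φ₁, hφ.prim.memLp_two.toLp φ)⟫_ℝ * Real.exp (l * T) =
      ⟪y0, WithLp.toLp 2 (h.prim.memLp_two.toLp φ₁, hφ.prim.memLp_two.toLp φ)⟫_ℝ := by
  set Φ₁ : L2 := h.prim.memLp_two.toLp φ₁ with hΦ₁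
  set Φ : L2 := hφ.prim.memLp_two.toLp φ with hΦ
  have hΦae : Φ =ᵐ[spaceMeasure] φ := hφ.prim.memLp_two.coeFn_toLp
  set F : State → ℝ := fun Y => ⟪Y, WithLp.toLp 2 (Φ₁, Φ)⟫_ℝ with hF
  have hFapp : ∀ Y : State, F Y = ⟪Y.fst, Φ₁⟫_ℝ + ⟪Y.snd, Φ⟫_ℝ := fun Y => rfl
  have hP : MemLp (fun x => P x / γ x) ⊤ spaceMeasure :=
    memLp_top_div hφ.flux.memLp_space hγ hc hcγ
  obtain ⟨z, hz, hH, hweak⟩ := hy.weak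
  set J : ℝ → ℝ := fun s => ∫ x in space, p x * (z s).fst x * φ x with hJ
  have hJint : ∀ t ∈ Icc 0 T, IntervalIntegrable J volume 0 t := by
    intro t ht
    have h1 : ∀ s, J s = ⟪z s, WithLp.toLp 2 (mulOp hp Φ, 0)⟫_ℝ := by
      intro s
      rw [WithLp.prod_inner_apply]
      simp only [inner_zero_right, add_zero]
      rw [inner_L2_eq]
      refine integral_congr_ae ?_
      filter_upwards [mulOp_ae hp Φ, hΦae] with x h1 h2
      simp only [WithLp.ofLp_fst] at *
      rw [h1, h2]
      ring
    rw [intervalIntegrable_iff_integrableOn_Ioo_of_le ht.1]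
    have h2 : IntegrableOn z (Ioo 0 t) := by
      have h3 : IntegrableOn z (Ioo 0 T) := hz.integrable one_le_two
      exact h3.mono_set (Ioo_subset_Ioo_right ht.2)
    exact (Integrable.inner_const (𝕜 := ℝ) h2 _).congr (Eventually.of_forall fun s => (h1 s).symm)
  have hcont : ∀ Ψ : State, ∀ t ∈ Icc 0 T, IntervalIntegrable (fun s => ⟪y s, Ψ⟫_ℝ) volume 0 t := by
    intro Ψ t ht
    refine ContinuousOn.intervalIntegrable ?_
    rw [uIcc_of_le ht.1]
    exact (hy.continuousOn.mono (Icc_subset_Icc_right ht.2)).inner continuousOn_const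
  have hFint : ∀ t ∈ Icc 0 T, IntervalIntegrable (fun s => F (y s)) volume 0 t := hcont _
  have hyint : ∀ t ∈ Icc 0 T, IntervalIntegrable (fun s => ⟪(y s).fst, Φ₁⟫_ℝ) volume 0 t := by
    intro t ht
    have h1 := hcont (WithLp.toLp 2 (Φ₁, 0)) t ht
    simpa [WithLp.prod_inner_apply] using h1
  have hI1 : ∀ᵐ s ∂(volume.restrict (Ioo 0 T)),
      (∫ x in space, (γ x * (z s).fst x * φ₁' x + γ₀ x * (y s).fst x * φ₁ x)) =
        l * ⟪(y s).fst, Φ₁⟫_ℝ - J s := by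
    filter_upwards [hH] with s hs
    have h1 := hs.1.integral_flux_eq h.flux
    rw [← integral_coe_mul_toLp _ h.prim.memLp_two, ← integral_const_mul, hJ]
    simp only
    rw [← integral_sub]
    · rw [← sub_eq_zero, ← integral_sub, ← h1]
      · refine integral_congr_ae ?_
        filter_upwards [h.flux_eq] with x hx
        rw [hx]
        ring
      · exact (integrable_mul_mul hγ h.bounded _).add
          (integrable_mul_mul hγ₀ h.prim.memLp_space _)
      · refine Integrable.sub ?_ (integrable_mul_mul hp hφ.prim.memLp_space _)
        simpa [mul_assoc] using (integrable_mul_mul (memLp_const l) h.prim.memLp_space (y s).fst)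
    · simpa [mul_assoc] using (integrable_mul_mul (memLp_const l) h.prim.memLp_space (y s).fst)
    · exact integrable_mul_mul hp hφ.prim.memLp_space _
  have hI2 : ∀ᵐ s ∂(volume.restrict (Ioo 0 T)),
      (∫ x in space, (γ x * (z s).snd x * (P x / γ x) + γ₀ x * (y s).snd x * φ x)) =
        l * ⟪(y s).snd, Φ⟫_ℝ := by
    filter_upwards [hH] with s hs
    have h1 := hs.2.integral_flux_eq hφ.flux
    rw [← integral_coe_mul_toLp _ hφ.prim.memLp_two, ← integral_const_mul, ← sub_eq_zero, ← integral_sub, ← h1]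
    · refine integral_congr_ae ?_
      filter_upwards [hcγ] with x hx
      have : γ x ≠ 0 := (hc.trans_le hx).ne'
      field_simp
      ring
    · exact (integrable_mul_mul hγ hP _).add (integrable_mul_mul hγ₀ hφ.prim.memLp_space _)
    · simpa [mul_assoc] using (integrable_mul_mul (memLp_const l) hφ.prim.memLp_space (y s).snd)
  have hcongr : ∀ t ∈ Icc 0 T, ∀ f g : ℝ → ℝ, (∀ᵐ s ∂(volume.restrict (Ioo 0 T)), f s = g s) →
      ∫ s in (0 : ℝ)..t, f s = ∫ s in (0 : ℝ)..t, g s := by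
    intro t ht f g hfg
    rw [intervalIntegral.integral_of_le ht.1, intervalIntegral.integral_of_le ht.1,
      integral_Ioc_eq_integral_Ioo, integral_Ioc_eq_integral_Ioo]
    exact integral_congr_ae (ae_restrict_of_ae_restrict_of_subset (Ioo_subset_Ioo_right ht.2) hfg)
  have hFeq : ∀ t ∈ Icc 0 T, F (y t) = F y0 + -l * ∫ s in (0 : ℝ)..t, F (y s) := by
    intro t ht
    have h1 := (hweak t ht φ₁ φ₁'
      (h.prim.isH10 (h.bounded.mono_exponent le_top) h.left h.right)).1
    have h2 := (hweak t ht φ (fun x => P x / γ x)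
      (hφ.prim.isH10 (hP.mono_exponent le_top) hφ.left hφ.right)).2
    have hv : ∀ s, ∫ x in space, O.indicator (fun x => v (s, x)) x * φ₁ x = 0 := by
      intro s
      refine integral_eq_zero_of_ae (Eventually.of_forall fun x => ?_)
      by_cases hx : x ∈ O
      · simp [h.vanish x hx]
      · simp [hx]
    have hr : ∀ s, ∫ x in space, (-0 * (y s).fst x - p x * (z s).fst x) * φ x = -J s := by
      intro s
      rw [hJ, ← integral_neg]
      congr 1; ext x; ring
    simp only [hv, intervalIntegral.integral_zero] at h1
    simp only [hr] at h2
    rw [hcongr t ht _ _ hI1, integral_coe_mul_toLp _ h.prim.memLp_two,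
      integral_coe_mul_toLp _ h.prim.memLp_two,
      intervalIntegral.integral_sub ((hyint t ht).const_mul l) (hJint t ht)] at h1
    rw [hcongr t ht _ _ hI2, integral_coe_mul_toLp _ hφ.prim.memLp_two,
      integral_coe_mul_toLp _ hφ.prim.memLp_two,
      intervalIntegral.integral_neg] at h2
    have h3 : ∫ s in (0 : ℝ)..t, F (y s) =
        (∫ s in (0 : ℝ)..t, ⟪(y s).fst, Φ₁⟫_ℝ) + ∫ s in (0 : ℝ)..t, ⟪(y s).snd, Φ⟫_ℝ := by
      rw [← intervalIntegral.integral_add (hyint t ht)]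
      · rfl
      · simpa [hFapp] using (hFint t ht).sub (hyint t ht)
    rw [intervalIntegral.integral_const_mul] at h1 h2
    rw [h3, hFapp, hFapp]
    linarith
  -- The right side of `hFeq` is absolutely continuous in time, and its product with `exp (l * t)`
  -- has zero derivative almost everywhere.
  have hG : IsPrim 0 T (fun t => F y0 + -l * ∫ s in (0 : ℝ)..t, F (y s))
      fun t => -l * F (y t) := by
    simpa using (IsPrim.const (F y0)).add
      ((IsPrim.of_integral (hFint T ⟨hT.le, le_rfl⟩) ⟨le_rfl, hT.le⟩).const_mul (-l))
  have hexp : IsPrim 0 T (fun t => Real.exp (l * t)) fun t => l * Real.exp (l * t) := by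
    have h1 : ContDiff ℝ 1 fun t => Real.exp (l * t) := by fun_prop
    refine (IsPrim.of_contDiff h1).congr_deriv (Eventually.of_forall fun t _ => ?_)
    have h2 : HasDerivAt (fun t => Real.exp (l * t)) (Real.exp (l * t) * (l * 1)) t :=
      ((hasDerivAt_id t).const_mul l).exp
    rw [h2.deriv]
    ring
  have h1 := (hG.mul hexp).integral_eq_sub hT.le
  rw [← hFeq T ⟨hT.le, le_rfl⟩, intervalIntegral.integral_same, intervalIntegral.integral_zero_ae]
    at h1
  · simp only [mul_zero, Real.exp_zero, add_zero, mul_one] at h1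
    linarith
  · refine Eventually.of_forall fun t ht => ?_
    rw [uIoc_of_le hT.le] at ht
    rw [← hFeq t (Ioc_subset_Icc_self ht)]
    ring

/-- The state `(0, Φ)` pairs to `1` with the mode. From zero initial data the pairing stays `0`, so
this state cannot be approached; started from it, the pairing never reaches `0`. -/
theorem IsUnobservable.not_controllable {γ γ₀ p : ℝ → ℝ} {O : Set ℝ} {l : ℝ}
    {φ P φ₁ φ₁' R : ℝ → ℝ}
    (hφ : IsEigenpair γ γ₀ l φ P) (h : IsUnobservable γ γ₀ p O l φ φ₁ φ₁' R)
    (hγ : MemLp γ ⊤ spaceMeasure) (hγ₀ : MemLp γ₀ ⊤ spaceMeasure) {c : ℝ} (hc : 0 < c)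
    (hcγ : ∀ᵐ x ∂spaceMeasure, c ≤ γ x) (hp : MemLp p ⊤ spaceMeasure) {T : ℝ} (hT : 0 < T) :
    ¬ ApproxControllable γ γ₀ p (fun _ => 0) O T ∧ ¬ NullControllable γ γ₀ p (fun _ => 0) O T := by
  set Φ₁ : L2 := h.prim.memLp_two.toLp φ₁ with hΦ₁
  set Φ : L2 := hφ.prim.memLp_two.toLp φ with hΦ
  set Ψ : State := WithLp.toLp 2 (Φ₁, Φ) with hΨ
  have hone : ⟪(WithLp.toLp 2 (0, Φ) : State), Ψ⟫_ℝ = 1 := by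
    rw [WithLp.prod_inner_apply]
    simp only [hΨ, inner_zero_left, zero_add]
    rw [← integral_coe_mul_toLp _ hφ.prim.memLp_two, ← hφ.norm]
    refine integral_congr_ae ?_
    filter_upwards [hφ.prim.memLp_two.coeFn_toLp] with x hx
    rw [hΦ, hx, sq]
  have hexp : Real.exp (l * T) ≠ 0 := (Real.exp_pos _).ne'
  constructor
  · intro hA
    obtain ⟨v, -, y, hy, hyT⟩ := hA (1 / (2 * (‖Ψ‖ + 1))) (by positivity) 0 (WithLp.toLp 2 (0, Φ))
    have h1 := h.evolution hφ hγ hγ₀ hc hcγ hp hT hy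
    rw [inner_zero_left, mul_eq_zero, or_iff_left hexp] at h1
    have h2 : |⟪y T - WithLp.toLp 2 (0, Φ), Ψ⟫_ℝ| = 1 := by
      rw [inner_sub_left, h1, hone]
      norm_num
    have h3 := abs_real_inner_le_norm (y T - WithLp.toLp 2 (0, Φ)) Ψ
    rw [h2] at h3
    have h4 : 1 ≤ 1 / (2 * (‖Ψ‖ + 1)) * ‖Ψ‖ :=
      h3.trans (mul_le_mul_of_nonneg_right hyT (norm_nonneg _))
    rw [one_div_mul_eq_div, le_div_iff₀ (by positivity)] at h4
    linarith [norm_nonneg Ψ]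
  · intro hN
    obtain ⟨v, -, y, hy, hyT⟩ := hN (WithLp.toLp 2 (0, Φ))
    have h1 := h.evolution hφ hγ hγ₀ hc hcγ hp hT hy
    rw [hyT, inner_zero_left, zero_mul, hone] at h1
    exact zero_ne_one h1

/-! ### Weak form of the eigenvalue equation and regularity of the reciprocal -/

theorem IsEigenpair.isNormalizedEigenfunction {γ γ₀ : ℝ → ℝ} {l : ℝ} {φ P : ℝ → ℝ}
    (hφ : IsEigenpair γ γ₀ l φ P) (hγ : MemLp γ ⊤ spaceMeasure) {c : ℝ} (hc : 0 < c)
    (hcγ : ∀ᵐ x ∂spaceMeasure, c ≤ γ x) : IsNormalizedEigenfunction γ γ₀ l φ := by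
  have hP : MemLp (fun x => P x / γ x) ⊤ spaceMeasure :=
    memLp_top_div hφ.flux.memLp_space hγ hc hcγ
  refine ⟨⟨hφ.prim.memLp_two.const_mul l, _,
    hφ.prim.isH10 (hP.mono_exponent le_top) hφ.left hφ.right, ?_⟩, hφ.norm⟩
  have hae : ∀ᵐ x, x ∈ Ioo 0 Real.pi → P x = γ x * (P x / γ x) := by
    refine ae_spaceMeasure_iff.1 ?_
    filter_upwards [hcγ] with x hx
    rw [mul_div_cancel₀ _ (hc.trans_le hx).ne']
  have hγP : IntegrableOn (fun x => γ x * (P x / γ x)) space :=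
    (hP.mul' (r := ⊤) hγ).integrable le_top
  have h1 := hφ.flux.congr_deriv (v' := fun x => γ₀ x * φ x - l * φ x)
    (Eventually.of_forall fun x _ => by ring)
  refine ⟨hγP.locallyIntegrableOn, (h1.hasWeakDerivOn Real.pi_pos.le).2.1, fun θ h2 h3 h4 => ?_⟩
  refine Eq.trans ?_ ((h1.hasWeakDerivOn Real.pi_pos.le).2.2 θ h2 h3 h4)
  refine integral_congr_ae ?_
  filter_upwards [ae_spaceMeasure_iff.2 hae] with x hx
  rw [← hx]

theorem MeasureTheory.MemLp.top_mul {μ : Measure ℝ} {f g : ℝ → ℝ} (hf : MemLp f ⊤ μ)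
    (hg : MemLp g ⊤ μ) : MemLp (fun x => f x * g x) ⊤ μ := hg.mul' hf

/-- The reciprocal of a `W^{2,∞}` function bounded below is `W^{2,∞}`. -/
theorem memWInf_two_of_eq_one_div {a b m : ℝ} {f g g' p : ℝ → ℝ} (hab : a ≤ b) (hm : 0 < m)
    (hf : IsPrim a b f g) (hg : IsPrim a b g g')
    (hg' : MemLp g' ⊤ (volume.restrict (Ioo a b))) (hmf : ∀ x ∈ Icc a b, m ≤ f x)
    (hp : ∀ x ∈ Icc a b, p x = 1 / f x) : MemWInf (Ioo a b) 2 p := by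
  -- Quotient rule with numerator `1` and the lower bound valid on all of `[a, b]`, so the vanishing
  -- condition is vacuous.
  have h1 := ((IsPrim.const (c := a) (d := b) 1).mul_inv_max hm hf
    (fun x hx hx' => absurd hx hx') hmf).congr hab (v := p) fun x hx => by
      rw [max_eq_left (hmf x hx), hp x hx, one_mul, one_div]
  have hp' : IsPrim a b p fun x => -1 * (g x * (p x * p x)) := by
    refine h1.congr_deriv (Eventually.of_forall fun x hx => ?_)
    have hx' := Ioo_subset_Icc_self hx
    rw [max_eq_left (hmf x hx'), hp x hx', one_div]
    ring
  have hpt := hp'.memLp_top hab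
  have hgt := hg.memLp_top hab
  have hp't : MemLp (fun x => -1 * (g x * (p x * p x))) ⊤ (volume.restrict (Ioo a b)) :=
    (hgt.top_mul (hpt.top_mul hpt)).const_mul (-1)
  have h2 := (hg.mul (hp'.mul hp')).const_mul (-1)
  refine ⟨hpt, _, hp'.hasWeakDerivOn hab, h2.memWInf_one hab (MemLp.const_mul ?_ (-1))⟩
  exact (hg'.top_mul (hpt.top_mul hpt)).add
    (hgt.top_mul ((hp't.top_mul hpt).add (hpt.top_mul hp't)))

/-! ### Construction of the coupling and of the unobservable mode -/

theorem mainTheorem3 (γ γ₀ : ℝ → ℝ)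
    (hγ : MemLp γ ∞ spaceMeasure) (hγ₀ : MemLp γ₀ ∞ spaceMeasure)
    (hγ_pos : ∃ c > 0, ∀ᵐ x ∂spaceMeasure, c ≤ γ x) :
    ∃ (p : ℝ → ℝ) (a b : ℝ),
      0 < a ∧ a < b ∧ b < Real.pi ∧
      MemWInf space 1 p ∧
      (essSupport p ∩ Ioo a b).Nonempty ∧
      (∀ T > 0, ¬ ApproxControllable γ γ₀ p (fun _ => 0) (Ioo a b) T ∧
        ¬ NullControllable γ γ₀ p (fun _ => 0) (Ioo a b) T) ∧
      (γ =ᵐ[spaceMeasure] (fun _ => 1) → γ₀ =ᵐ[spaceMeasure] (fun _ => 0) →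
        MemWInf (Ioo a b) 2 p) ∧
      ∃ (l : ℝ) (φ w : ℝ → ℝ),
        IsNormalizedEigenfunction γ γ₀ l φ ∧
        (∀ᵐ x ∂(volume.restrict (Ioo a b)), p x = 1 / φ x ∧ φ x ≠ 0) ∧
        HasWeakDerivOn space (fun x => p x * φ x) w ∧ MemLp w 2 spaceMeasure ∧
        (∫ x in Ioo 0 a, w x * φ x) = 0 ∧
        (∫ x in Ioo b Real.pi, w x * φ x) = 0 := by
  obtain ⟨c, hc, hcγ⟩ := hγ_pos
  have hπ := Real.pi_pos
  obtain ⟨l, φ₀, P₀, h₀⟩ := exists_eigenpair hγ hγ₀ hc hcγ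
  obtain ⟨φ, P, hφ, x₀, hx₀, hφx₀⟩ := h₀.exists_pos
  have hφc := hφ.prim.continuousOn hπ.le
  obtain ⟨m, α, a, b, β, hm, hα, hαa, hab, hbβ, hβ, hmφ, hφα, hφβ⟩ :=
    exists_nested_intervals hφc hφ.left hφ.right hx₀ hφx₀
  obtain ⟨w, hw, hw0, hG1, hG0, hk1, hk0, hkπ⟩ :=
    exists_cutoff hφc hα hαa hab hbβ hβ hφα hφβ
  have hw : MemLp w ⊤ spaceMeasure := hw
  have hab' : Icc a b ⊆ Icc α β := Icc_subset_Icc hαa.le hbβ.le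
  have hαβ' : Icc α β ⊆ Icc 0 Real.pi := Icc_subset_Icc hα hβ
  have ha0 : 0 < a := hα.trans_lt hαa
  have hbπ : b < Real.pi := hbβ.trans_le hβ
  have hφw : MemLp (fun x => φ x * w x) ⊤ spaceMeasure := hw.mul' hφ.prim.memLp_space
  set G : ℝ → ℝ := fun x => ∫ t in (0 : ℝ)..x, w t with hGdef
  have hG : IsPrim 0 Real.pi G w :=
    IsPrim.of_integral (hw.intervalIntegrable_space le_top) ⟨le_rfl, hπ.le⟩
  set k : ℝ → ℝ := fun x => ∫ t in (0 : ℝ)..x, φ t * w t with hkdef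
  have hk : IsPrim 0 Real.pi k fun x => φ x * w x :=
    IsPrim.of_integral (hφw.intervalIntegrable_space le_top) ⟨le_rfl, hπ.le⟩
  -- A bounded reciprocal defined everywhere: it equals `1 / φ` on `[α, β]`, and elsewhere it only
  -- multiplies functions that vanish.
  set ψ : ℝ → ℝ := fun x => (max (φ x) m)⁻¹ with hψdef
  have hψφ : ∀ x ∈ Icc α β, ψ x * φ x = 1 := fun x hx => by
    simp only [hψdef, max_eq_left (hmφ x hx)]
    exact inv_mul_cancel₀ (hm.trans_le (hmφ x hx)).ne'
  have hψc : ContinuousOn ψ (Icc 0 Real.pi) :=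
    (hφc.sup continuousOn_const).inv₀ fun x _ => (hm.trans_le (le_max_right _ _)).ne'
  have hψ : MemLp ψ ⊤ spaceMeasure := by
    obtain ⟨C, hC⟩ := isCompact_Icc.exists_bound_of_continuousOn hψc
    refine memLp_top_of_bound ((hψc.mono
      Ioo_subset_Icc_self).aestronglyMeasurable measurableSet_Ioo) C ?_
    filter_upwards [(ae_restrict_mem measurableSet_Ioo : ∀ᵐ x ∂spaceMeasure, _)] with x hx
    exact hC x (Ioo_subset_Icc_self hx)
  have hP : MemLp (fun x => P x / γ x) ⊤ spaceMeasure :=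
    memLp_top_div hφ.flux.memLp_space hγ hc hcγ
  have hψ2 : MemLp (fun x => ψ x ^ 2) ⊤ spaceMeasure := by
    simpa only [sq] using hψ.mul' (r := ⊤) hψ
  -- The coupling coefficient.
  set p : ℝ → ℝ := fun x => G x * ψ x with hpdef
  have hp : IsPrim 0 Real.pi p fun x => w x * ψ x - G x * (P x / γ x) * ψ x ^ 2 :=
    hG.mul_inv_max hm hφ.prim hG0 hmφ
  have hp' : MemLp (fun x => w x * ψ x - G x * (P x / γ x) * ψ x ^ 2) ⊤ spaceMeasure :=
    (hψ.mul' (r := ⊤) hw).sub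
      (hψ2.mul' (r := ⊤) (hP.mul' (r := ⊤) hG.memLp_space))
  have hpφ : ∀ x ∈ Icc 0 Real.pi, p x * φ x = G x := fun x hx => by
    by_cases h : x ∈ Icc α β
    · rw [hpdef]
      simp only
      rw [mul_assoc, hψφ x h, mul_one]
    · rw [hpdef]
      simp only
      rw [hGdef]
      simp only [hG0 x hx h, zero_mul]
  have hp1 : ∀ x ∈ Icc a b, p x = 1 / φ x := fun x hx => by
    have h1 := hpφ x (hαβ' (hab' hx))
    have h2 : G x = 1 := hG1 x hx
    rw [h2] at h1
    exact eq_one_div_of_mul_eq_one_left h1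
  have hφne : ∀ x ∈ Icc α β, φ x ≠ 0 := fun x hx => (hm.trans_le (hmφ x hx)).ne'
  -- The first component of the unobservable mode is `φ h`.
  have hκ : MemLp (fun x => k x * ψ x ^ 2) ⊤ spaceMeasure := hψ2.mul' (r := ⊤) hk.memLp_space
  have hκγ := memLp_top_div hκ hγ hc hcγ
  -- This is `h' = -k / (γ φ²)`, integrated from `a` so that `h = 0` on `[a, b]`, where `k = 0`.
  set h : ℝ → ℝ := fun x => ∫ t in a..x, -1 * (k t * ψ t ^ 2 / γ t) with hhdef
  have hh : IsPrim 0 Real.pi h fun x => -1 * (k x * ψ x ^ 2 / γ x) :=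
    IsPrim.of_integral ((hκγ.const_mul (-1)).intervalIntegrable_space le_top)
      ⟨ha0.le, (hab.trans hbπ).le⟩
  have hh0 : ∀ x ∈ Icc a b, h x = 0 := fun x hx => by
    refine intervalIntegral.integral_zero_ae (Eventually.of_forall fun t ht => ?_)
    rw [uIoc_of_le hx.1] at ht
    have : k t = 0 := hk1 t ⟨ht.1.le, ht.2.trans hx.2⟩
    rw [this]
    ring
  have hkψ : IsPrim 0 Real.pi (fun x => k x * ψ x)
      fun x => φ x * w x * ψ x - k x * (P x / γ x) * ψ x ^ 2 :=
    hk.mul_inv_max hm hφ.prim hk0 hmφ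
  have hφ₁ := hφ.prim.mul hh
  have hunobs : IsUnobservable γ γ₀ p (Ioo a b) l φ (fun x => φ x * h x)
      (fun x => P x / γ x * h x + φ x * (-1 * (k x * ψ x ^ 2 / γ x)))
      -- The flux `γ (φ h)' + p φ` after inserting `γ φ² h' = -k`. In its derivative the terms in
      -- `k` cancel, and `-φ w ψ` cancels `G' = w`, leaving `(γ₀ - l) φ h`.
      (fun x => P x * h x + (-1 * (k x * ψ x) + G x)) := by
    refine ⟨hφ₁, ?_, by simp [hφ.left], by simp [hφ.right], fun x hx => ?_, ?_, ?_⟩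
    · exact (hh.memLp_space.mul' (r := ⊤) hP).add
        ((hκγ.const_mul (-1)).mul' (r := ⊤) hφ.prim.memLp_space)
    · simp only [hh0 x (Ioo_subset_Icc_self hx), mul_zero]
    · refine ((hφ.flux.mul hh).add ((hkψ.const_mul (-1)).add hG)).congr_deriv
        (Eventually.of_forall fun x hx => ?_)
      have hwψ : w x * (ψ x * φ x) = w x := by
        by_cases hxm : x ∈ Icc α β
        · rw [hψφ x hxm, mul_one]
        · rw [hw0 x hxm, zero_mul]
      linear_combination -hwψ
    · refine ae_spaceMeasure_iff.2 ?_
      filter_upwards [ae_spaceMeasure_iff.1 hcγ] with x hγx hx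
      have hx' := Ioo_subset_Icc_self hx
      have hγ0 : γ x ≠ 0 := (hc.trans_le (hγx hx)).ne'
      have hkψ' : k x * ψ x * (ψ x * φ x) = k x * ψ x := by
        by_cases hxm : x ∈ Icc α β
        · rw [hψφ x hxm, mul_one]
        · have : k x = 0 := hk0 x hx' hxm
          rw [this, zero_mul, zero_mul]
      rw [hpφ x hx']
      field_simp
      linear_combination hkψ'
  have hwG : ∀ x, w x * φ x = φ x * w x := fun x => mul_comm _ _
  refine ⟨p, a, b, ha0, hab, hbπ, hp.memWInf_one hπ.le hp', ?_, fun T hT =>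
    hunobs.not_controllable hφ hγ hγ₀ hc hcγ hp.memLp_space hT, fun hγ1 _ => ?_,
    l, φ, w, hφ.isNormalizedEigenfunction hγ hc hcγ, ?_, ?_, hw.mono_exponent le_top, ?_, ?_⟩
  · have hmid : (a + b) / 2 ∈ Ioo a b := ⟨by linarith, by linarith⟩
    refine ⟨(a + b) / 2, ⟨⟨by linarith, by linarith⟩, fun U hU h0 => ?_⟩, hmid⟩
    have h1 : U ∩ Ioo a b ∈ 𝓝 ((a + b) / 2) := inter_mem hU (isOpen_Ioo.mem_nhds hmid)
    refine (Measure.measure_pos_of_mem_nhds volume h1).ne' (measure_mono_null ?_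
      ((Measure.restrict_apply' (measurableSet_Ioo : MeasurableSet space)).symm.trans h0))
    intro x hx
    have hx' : x ∈ Icc a b := Ioo_subset_Icc_self hx.2
    have hpx : p x ≠ 0 := by
      rw [hp1 x hx']
      exact one_div_ne_zero (hφne x (hab' hx'))
    exact ⟨⟨hx.1, hpx⟩, ha0.trans hx.2.1, hx.2.2.trans hbπ⟩
  · have hsub : Ioo a b ⊆ space := Ioo_subset_Ioo ha0.le hbπ.le
    -- When `γ = 1` the flux `P` is `φ'` itself, so `φ'` is absolutely continuous with bounded
    -- derivative.
    refine memWInf_two_of_eq_one_div hab.le hm ((hφ.prim.mono hab.le ha0.le hbπ.le).congr_deriv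
      (v' := P) ?_) (hφ.flux.mono hab.le ha0.le hbπ.le)
      (MemLp.mono_measure (Measure.restrict_mono_set _ hsub) ?_)
      (fun x hx => hmφ x (hab' hx)) hp1
    · filter_upwards [ae_spaceMeasure_iff.1 hγ1] with x hx hx'
      rw [hx (hsub hx'), div_one]
    · exact (hγ₀.sub (memLp_const l)).top_mul hφ.prim.memLp_space
  · filter_upwards [ae_restrict_mem measurableSet_Ioo] with x hx
    exact ⟨hp1 x (Ioo_subset_Icc_self hx), hφne x (hab' (Ioo_subset_Icc_self hx))⟩
  · exact (hG.congr hπ.le fun x hx => (hpφ x hx).symm).hasWeakDerivOn hπ.le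
  · simp only [hwG]
    rw [← integral_Ioc_eq_integral_Ioo, ← intervalIntegral.integral_of_le ha0.le]
    exact hk1 a ⟨le_rfl, hab.le⟩
  · simp only [hwG]
    have hi : ∀ x ∈ Icc 0 Real.pi, IntervalIntegrable (fun t => φ t * w t) volume 0 x :=
      fun x hx => (hφw.intervalIntegrable_space le_top).mono_set
        (by rw [uIcc_of_le hx.1, uIcc_of_le hπ.le]; exact Icc_subset_Icc_right hx.2)
    -- The integral over `(b, π)` is `k π - k b`, and both values vanish.
    rw [← integral_Ioc_eq_integral_Ioo, ← intervalIntegral.integral_of_le hbπ.le,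
      ← intervalIntegral.integral_interval_sub_left (hi _ ⟨hπ.le, le_rfl⟩)
        (hi b ⟨by linarith, hbπ.le⟩), hkπ]
    rw [hk1 b ⟨hab.le, le_rfl⟩, sub_zero]
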